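/- **Setting.** Fix a finite set $\mathscr U$ of unitary operators $\mathbf U$ on $\mathbb C^{2^n}$, each with a symbol $U$ and an arity $n\ge 1$. Terms of $\mathsf Q\Lambda$, modulo renaming of bound variables, are $M,N ::= x \mid |b\rangle_n \mid U \mid M\otimes N \mid MN \mid \lambda x.M \mid \lambda\langle x,y\rangle.M$, where $b\in\{0,1\}$ and the labels $n\in\mathbb N$ of the bit constants of a term are pairwise distinct; variables are totally ordered. Types are $A ::= \mathbb B \mid A\multimap B \mid A\otimes B$. Type derivations $\pi\rhd\Gamma\vdash M:A$, with $\Gamma$ a finite set of assignments $x:A$ with distinct variables, are built from the axioms $x:A\vdash x:A$, $\;\vdash |b\rangle_n:\mathbb B$, $\;\vdash U:\mathbb B^n\multimap\mathbb B^n$ ($n$ the arity of $U$, $\mathbb B^n$ the $n$-fold tensor product), and the rules: from $\Gamma,x:A\vdash M:B$ infer $\Gamma\vdash\lambda x.M:A\multimap B$; from $\Gamma,x:A,y:B\vdash M:C$ infer $\Gamma\vdash\lambda\langle x,y\rangle.M:A\otimes B\multimap C$; from $\Gamma\vdash M:A\multimap B$ and $\Delta\vdash N:A$ infer $\Gamma,\Delta\vdash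 MN:B$; from $\Gamma\vdash M:A$ and $\Delta\vdash N:B$ infer $\Gamma,\Delta\vdash M\otimes N:A\otimes B$ ($\Gamma$ and $\Delta$ with disjoint variables). **The machine $\mathcal K_\pi$.** An occurrence of $\mathbb B$ in $\pi$ is an occurrence of $\mathbb B$ in a type of some judgement of $\pi$ (in the type of the term or in the type of a variable of the environment); it is positive or negative in that type in the usual sense ($\multimap$ reverses the sign on its left, $\otimes$ preserves it). A state with $n$ tokens is $(O_1,\dots,O_n,\mathbf Q)$, where $O_1,\dots,O_n$ are pairwise distinct occurrences of $\mathbb B$ in $\pi$ and $\mathbf Q$ is a quantum register, i.e. a normalised vector of $\mathbb C^{2^n}$. The transition relation $\to_\pi$ has two kinds of steps. * *Moves.* One token moves between corresponding occurrences of two identified types at an instance of a rule, and the register is unchanged. The identified types are: the two copies of $A$ in $x:A\vdash x:A$; each environment type in the conclusion of a rule and its copy in a premise; for the two abstraction rules, the types of the abstracted variables in the premise and the corresponding parts of the left-hand side of $\multimap$ in the conclusion, and the types of the bodies; for application, $A$ in the type $A\multimap B$ of $M$ and the type $A$ of $N$, and the two copies of $B$; for pairs, the types $A$ and $B$ of the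 premises and the two components of $A\otimes B$. Within the type of the term, tokens on negative occurrences of a conclusion go up to the premises and tokens on positive occurrences of a premise go down to the conclusion; within environments, positive occurrences go up and negative ones go down. At a variable axiom tokens cross from left to right on positive occurrences and from right to left on negative ones. At an application, tokens pass from the type $A$ of $N$ to the $A$ in $A\multimap B$ on positive occurrences of $A$, and back on negative ones. * *Synchronised steps.* At an axiom $\vdash U:\mathbb B_1\otimes\cdots\otimes\mathbb B_m\multimap\mathbb B_{m+1}\otimes\cdots\otimes\mathbb B_{2m}$, if $\mathbb B_1,\dots,\mathbb B_m$ all carry tokens, at the positions $i_1,\dots,i_m$ of the state, then all these tokens move together to $\mathbb B_{m+1},\dots,\mathbb B_{2m}$ respectively, and $\mathbf Q$ becomes $\mathbf U^{i_1,\dots,i_m}(\mathbf Q)$: $\mathbf U$ acts on the qubits $i_1,\dots,i_m$ and the others are unchanged. Let $\pi\rhd\Gamma\vdash M:A$. Its inputs are the sequence of the positive occurrences of $\mathbb B$ in the types of $\Gamma$ (in the order of the variables) followed by the negative occurrences in $A$, in the concluding judgement; its outputs are the sequence of the negative occurrences in $\Gamma$ followed by the positive ones in $A$. For $\Gamma$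 empty these are just the negative and the positive occurrences in $A$. The initial state for a register $\mathbf Q$ with one qubit per input has its tokens at the inputs followed by the occurrences of $\mathbb B$ introduced by the axioms $\vdash|b\rangle_n:\mathbb B$ of $\pi$, in the order of their labels, and its register is $\mathbf Q\otimes|b_1\cdots b_l\rangle$ with $b_1,\dots,b_l$ the corresponding bits. A state is final if its sequence of occurrences is a permutation of the sequence of outputs. The function computed by $\pi$ is defined at $\mathbf Q$, with value $\mathbf R$, if the initial state for $\mathbf Q$ rewrites, in finitely many steps of $\to_\pi$, to a final state whose register, once its qubits are listed in the order of the outputs, is $\mathbf R$. **Proposition (Progress).** Let $\pi$ be a type derivation of $\mathsf Q\Lambda$. 1. If $\mathsf S$ is an initial state of $\mathcal K_\pi$ and $\mathsf S\to_\pi^*\mathsf R$, then either $\mathsf R$ is final or $\mathsf R\to_\pi\mathsf T$ for some state $\mathsf T$ of $\mathcal K_\pi$. 2. The function computed by $\pi$ is total: for every quantum register $\mathbf Q$ with one qubit per input there is a quantum register $\mathbf R$ with one qubit per output such that the function computed by $\pi$ is defined at $\mathbf Q$ with value $\mathbf R$. -/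

import Mathlib

namespace QLambda

/-! ### Syntax -/

/-- A finite set of unitary operators, each given by a symbol `U`, its arity `n` and a unitary
operator on `ℂ^{2^n}`, whose standard basis is indexed by bit strings `Fin n → Bool`.  Arities are
positive because the type of `U` mentions the `n`-fold tensor power of `𝔹`. -/
structure Signature where
  Sym : Type
  finite_sym : Finite Sym
  arity : Sym → ℕ
  arity_pos : ∀ U, 0 < arity U
  op : ∀ U, Matrix.unitaryGroup (Fin (arity U) → Bool) ℂ

/-- Types: `𝔹`, `A ⊸ B`, `A ⊗ B`. -/
inductive Ty : Type
  | bit : Ty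
  | lolli : Ty → Ty → Ty
  | tens : Ty → Ty → Ty

/-- `𝔹 ⊗ (𝔹 ⊗ (… ⊗ 𝔹))` with `n` factors, for `n ≥ 1` (the value at `0` is never used). -/
def Ty.pow : ℕ → Ty
  | 0 => .bit
  | 1 => .bit
  | n + 2 => .tens .bit (Ty.pow (n + 1))

/-- Terms modulo renaming of bound variables, in locally nameless style: free variables are
names in `ℕ`, bound variables are indices.  `lam` binds index `0`; `lamPair` binds indices `1`
(first component) and `0` (second component). `bit b n` is the constant `|b⟩` with label `n`. -/
inductive Term (𝒰 : Signature) : Type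
  | fvar : ℕ → Term 𝒰
  | bvar : ℕ → Term 𝒰
  | bit : Bool → ℕ → Term 𝒰
  | unitary : 𝒰.Sym → Term 𝒰
  | tens : Term 𝒰 → Term 𝒰 → Term 𝒰
  | app : Term 𝒰 → Term 𝒰 → Term 𝒰
  | lam : Term 𝒰 → Term 𝒰
  | lamPair : Term 𝒰 → Term 𝒰

namespace Term

variable {𝒰 : Signature}

/-- Replace the free variable `x` by the bound variable with index `k`. -/
def close (x : ℕ) : ℕ → Term 𝒰 → Term 𝒰
  | k, fvar y => if y = x then bvar k else fvar y
  | _, bvar i => bvar i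
  | _, bit b n => bit b n
  | _, unitary U => unitary U
  | k, tens M N => tens (close x k M) (close x k N)
  | k, app M N => app (close x k M) (close x k N)
  | k, lam M => lam (close x (k + 1) M)
  | k, lamPair M => lamPair (close x (k + 2) M)

/-- `λx.M` -/
def abs (x : ℕ) (M : Term 𝒰) : Term 𝒰 := lam (close x 0 M)

/-- `λ⟨x,y⟩.M` -/
def absPair (x y : ℕ) (M : Term 𝒰) : Term 𝒰 := lamPair (close y 0 (close x 1 M))

/-- The labels of the bit constants occurring in a term, with multiplicity. -/
def labels : Term 𝒰 → List ℕ
  | fvar _ => []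
  | bvar _ => []
  | bit _ n => [n]
  | unitary _ => []
  | tens M N => labels M ++ labels N
  | app M N => labels M ++ labels N
  | lam M => labels M
  | lamPair M => labels M

end Term

/-! ### Type derivations -/

/-- Linear environments: finite sets of assignments `x : A`, each variable at most once. -/
abbrev Env : Type := Finmap (fun _ : ℕ => Ty)

/-- `Deriv 𝒰 Γ M A` is the type of type derivations of the judgement `Γ ⊢ M : A`. -/
inductive Deriv (𝒰 : Signature) : Env → Term 𝒰 → Ty → Type
  | var (x : ℕ) (A : Ty) : Deriv 𝒰 (Finmap.singleton x A) (.fvar x) A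
  | bit (b : Bool) (n : ℕ) : Deriv 𝒰 ∅ (.bit b n) .bit
  | unitary (U : 𝒰.Sym) :
      Deriv 𝒰 ∅ (.unitary U) (.lolli (Ty.pow (𝒰.arity U)) (Ty.pow (𝒰.arity U)))
  | lam {Γ : Env} {M : Term 𝒰} {B : Ty} (x : ℕ) (A : Ty) (hx : x ∉ Γ)
      (π : Deriv 𝒰 (Γ.insert x A) M B) : Deriv 𝒰 Γ (.abs x M) (.lolli A B)
  | lamPair {Γ : Env} {M : Term 𝒰} {C : Ty} (x y : ℕ) (A B : Ty)
      (hx : x ∉ Γ) (hy : y ∉ Γ) (hxy : x ≠ y)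
      (π : Deriv 𝒰 ((Γ.insert x A).insert y B) M C) :
      Deriv 𝒰 Γ (.absPair x y M) (.lolli (.tens A B) C)
  | app {Γ Δ : Env} {M N : Term 𝒰} {A B : Ty} (hΓΔ : Γ.Disjoint Δ)
      (π : Deriv 𝒰 Γ M (.lolli A B)) (ρ : Deriv 𝒰 Δ N A) : Deriv 𝒰 (Γ ∪ Δ) (.app M N) B
  | tens {Γ Δ : Env} {M N : Term 𝒰} {A B : Ty} (hΓΔ : Γ.Disjoint Δ)
      (π : Deriv 𝒰 Γ M A) (ρ : Deriv 𝒰 Δ N B) : Deriv 𝒰 (Γ ∪ Δ) (.tens M N) (.tens A B)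

/-! ### Occurrences of `𝔹` -/

/-- `Hole A` is the type of contexts `C` for `A`, i.e. of types with one hole such that
`C[𝔹] = A`. -/
inductive Hole : Ty → Type
  | here : Hole .bit
  | tensL {A B : Ty} (C : Hole A) : Hole (.tens A B)
  | tensR {A B : Ty} (C : Hole B) : Hole (.tens A B)
  | lolliL {A B : Ty} (C : Hole A) : Hole (.lolli A B)
  | lolliR {A B : Ty} (C : Hole B) : Hole (.lolli A B)

/-- The polarity of the hole: `true` for positive contexts, `false` for negative ones. -/
def Hole.sign : {A : Ty} → Hole A → Bool
  | _, here => true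
  | _, tensL C => C.sign
  | _, tensR C => C.sign
  | _, lolliL C => !C.sign
  | _, lolliR C => C.sign

/-- Positive contexts. -/
def Hole.Pos {A : Ty} (C : Hole A) : Prop := C.sign = true

/-- Negative contexts. -/
def Hole.Neg {A : Ty} (C : Hole A) : Prop := C.sign = false

/-- `holes true A` and `holes false A` are the sequences of the positive and of the negative
occurrences of `𝔹` in `A`. -/
def holes : Bool → (A : Ty) → List (Hole A)
  | true, .bit => [.here]
  | false, .bit => []
  | s, .tens A B => (holes s A).map .tensL ++ (holes s B).map .tensR
  | s, .lolli A B => (holes (!s) A).map .lolliL ++ (holes s B).map .lolliR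

/-- The `k`-th occurrence of `𝔹` in the `n`-fold tensor power of `𝔹`. -/
def Hole.pow : (n : ℕ) → Fin n → Hole (Ty.pow n)
  | 0, k => k.elim0
  | 1, _ => .here
  | n + 2, k => Fin.cases (motive := fun _ => Hole (Ty.pow (n + 2)))
      (.tensL .here) (fun j => .tensR (Hole.pow (n + 1) j)) k

/-- Occurrences of `𝔹` in a judgement `Γ ⊢ M : A`: in the type of a variable of `Γ`, or in `A`. -/
inductive JOcc (Γ : Env) (A : Ty) : Type
  | hyp (x : ℕ) (B : Ty) (h : Γ.lookup x = some B) (C : Hole B)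
  | goal (C : Hole A)

/-- Occurrences in a derivation ending in a rule with one premise: those in the concluding
judgement, and those in the derivation of the premise. -/
inductive Occ₁ (J P : Type) : Type
  | root (o : J)
  | prem (o : P)

/-- Occurrences in a derivation ending in a rule with two premises. -/
inductive Occ₂ (J P₁ P₂ : Type) : Type
  | root (o : J)
  | left (o : P₁)
  | right (o : P₂)

/-- Occurrences of `𝔹` in a type derivation. -/
def Occ {𝒰 : Signature} : {Γ : Env} → {M : Term 𝒰} → {A : Ty} → Deriv 𝒰 Γ M A → Type
  | _, _, _, .var x A => JOcc (Finmap.singleton x A) A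
  | _, _, _, .bit _ _ => JOcc ∅ .bit
  | _, _, _, .unitary U => JOcc ∅ (.lolli (Ty.pow (𝒰.arity U)) (Ty.pow (𝒰.arity U)))
  | _, _, _, .lam (Γ := Γ) (B := B) _ A _ π => Occ₁ (JOcc Γ (.lolli A B)) (Occ π)
  | _, _, _, .lamPair (Γ := Γ) (C := C) _ _ A B _ _ _ π =>
      Occ₁ (JOcc Γ (.lolli (.tens A B) C)) (Occ π)
  | _, _, _, .app (Γ := Γ) (Δ := Δ) (B := B) _ π ρ => Occ₂ (JOcc (Γ ∪ Δ) B) (Occ π) (Occ ρ)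
  | _, _, _, .tens (Γ := Γ) (Δ := Δ) (A := A) (B := B) _ π ρ =>
      Occ₂ (JOcc (Γ ∪ Δ) (.tens A B)) (Occ π) (Occ ρ)

/-- The occurrences in the concluding judgement of a derivation. -/
def root {𝒰 : Signature} : {Γ : Env} → {M : Term 𝒰} → {A : Ty} → (π : Deriv 𝒰 Γ M A) →
    JOcc Γ A → Occ π
  | _, _, _, .var _ _, o => o
  | _, _, _, .bit _ _, o => o
  | _, _, _, .unitary _, o => o
  | _, _, _, .lam _ _ _ _, o => Occ₁.root o
  | _, _, _, .lamPair _ _ _ _ _ _ _ _, o => Occ₁.root o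
  | _, _, _, .app _ _ _, o => Occ₂.root o
  | _, _, _, .tens _ _ _, o => Occ₂.root o

/-! The inclusions of the occurrences in the derivations of the premises. -/

def inLam {𝒰 : Signature} {Γ : Env} {M : Term 𝒰} {B : Ty} (x : ℕ) (A : Ty) (hx : x ∉ Γ)
    (π : Deriv 𝒰 (Γ.insert x A) M B) (o : Occ π) : Occ (.lam x A hx π) := Occ₁.prem o

def inLamPair {𝒰 : Signature} {Γ : Env} {M : Term 𝒰} {C : Ty} (x y : ℕ) (A B : Ty)
    (hx : x ∉ Γ) (hy : y ∉ Γ) (hxy : x ≠ y) (π : Deriv 𝒰 ((Γ.insert x A).insert y B) M C)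
    (o : Occ π) : Occ (.lamPair x y A B hx hy hxy π) := Occ₁.prem o

def inAppL {𝒰 : Signature} {Γ Δ : Env} {M N : Term 𝒰} {A B : Ty} (h : Γ.Disjoint Δ)
    (π : Deriv 𝒰 Γ M (.lolli A B)) (ρ : Deriv 𝒰 Δ N A) (o : Occ π) : Occ (.app h π ρ) :=
  Occ₂.left o

def inAppR {𝒰 : Signature} {Γ Δ : Env} {M N : Term 𝒰} {A B : Ty} (h : Γ.Disjoint Δ)
    (π : Deriv 𝒰 Γ M (.lolli A B)) (ρ : Deriv 𝒰 Δ N A) (o : Occ ρ) : Occ (.app h π ρ) :=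
  Occ₂.right o

def inTensL {𝒰 : Signature} {Γ Δ : Env} {M N : Term 𝒰} {A B : Ty} (h : Γ.Disjoint Δ)
    (π : Deriv 𝒰 Γ M A) (ρ : Deriv 𝒰 Δ N B) (o : Occ π) : Occ (.tens h π ρ) := Occ₂.left o

def inTensR {𝒰 : Signature} {Γ Δ : Env} {M N : Term 𝒰} {A B : Ty} (h : Γ.Disjoint Δ)
    (π : Deriv 𝒰 Γ M A) (ρ : Deriv 𝒰 Δ N B) (o : Occ ρ) : Occ (.tens h π ρ) := Occ₂.right o

/-! ### Moves of a single token

One inductive relation for each typing rule that moves tokens one at a time.  In the rules with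
premises, `r` embeds the occurrences of the judgement of a premise, and `m` is the relation
already defined on the derivation of that premise. -/

/-- Moves at a variable axiom `x : A ⊢ x : A`. -/
inductive VarMove (x : ℕ) (A : Ty) :
    JOcc (Finmap.singleton x A) A → JOcc (Finmap.singleton x A) A → Prop
  | pos (C : Hole A) (h) (hC : C.Pos) : VarMove x A (.hyp x A h C) (.goal C)
  | neg (C : Hole A) (h) (hC : C.Neg) : VarMove x A (.goal C) (.hyp x A h C)

/-- Moves at an abstraction `λx.M`. -/
inductive LamMove {Γ : Env} {x : ℕ} {A B : Ty} {P : Type} (r : JOcc (Γ.insert x A) B → P)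
    (m : P → P → Prop) :
    Occ₁ (JOcc Γ (.lolli A B)) P → Occ₁ (JOcc Γ (.lolli A B)) P → Prop
  | prem (o o' : P) (h : m o o') : LamMove r m (.prem o) (.prem o')
  | arg_neg (C : Hole A) (h) (hC : C.Neg) :
      LamMove r m (.prem (r (.hyp x A h C))) (.root (.goal (.lolliL C)))
  | arg_pos (C : Hole A) (h) (hC : C.Pos) :
      LamMove r m (.root (.goal (.lolliL C))) (.prem (r (.hyp x A h C)))
  | body_pos (C : Hole B) (hC : C.Pos) :
      LamMove r m (.prem (r (.goal C))) (.root (.goal (.lolliR C)))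
  | body_neg (C : Hole B) (hC : C.Neg) :
      LamMove r m (.root (.goal (.lolliR C))) (.prem (r (.goal C)))
  | env_pos (z : ℕ) (D : Ty) (h h') (C : Hole D) (hC : C.Pos) :
      LamMove r m (.root (.hyp z D h C)) (.prem (r (.hyp z D h' C)))
  | env_neg (z : ℕ) (D : Ty) (h h') (C : Hole D) (hC : C.Neg) :
      LamMove r m (.prem (r (.hyp z D h' C))) (.root (.hyp z D h C))

/-- Moves at an abstraction `λ⟨x,y⟩.M`. -/
inductive LamPairMove {Γ : Env} {x y : ℕ} {A B E : Ty} {P : Type}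
    (r : JOcc ((Γ.insert x A).insert y B) E → P) (m : P → P → Prop) :
    Occ₁ (JOcc Γ (.lolli (.tens A B) E)) P → Occ₁ (JOcc Γ (.lolli (.tens A B) E)) P → Prop
  | prem (o o' : P) (h : m o o') : LamPairMove r m (.prem o) (.prem o')
  | fst_neg (C : Hole A) (h) (hC : C.Neg) :
      LamPairMove r m (.prem (r (.hyp x A h C))) (.root (.goal (.lolliL (.tensL C))))
  | fst_pos (C : Hole A) (h) (hC : C.Pos) :
      LamPairMove r m (.root (.goal (.lolliL (.tensL C)))) (.prem (r (.hyp x A h C)))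
  | snd_neg (C : Hole B) (h) (hC : C.Neg) :
      LamPairMove r m (.prem (r (.hyp y B h C))) (.root (.goal (.lolliL (.tensR C))))
  | snd_pos (C : Hole B) (h) (hC : C.Pos) :
      LamPairMove r m (.root (.goal (.lolliL (.tensR C)))) (.prem (r (.hyp y B h C)))
  | body_pos (C : Hole E) (hC : C.Pos) :
      LamPairMove r m (.prem (r (.goal C))) (.root (.goal (.lolliR C)))
  | body_neg (C : Hole E) (hC : C.Neg) :
      LamPairMove r m (.root (.goal (.lolliR C))) (.prem (r (.goal C)))
  | env_pos (z : ℕ) (D : Ty) (h h') (C : Hole D) (hC : C.Pos) :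
      LamPairMove r m (.root (.hyp z D h C)) (.prem (r (.hyp z D h' C)))
  | env_neg (z : ℕ) (D : Ty) (h h') (C : Hole D) (hC : C.Neg) :
      LamPairMove r m (.prem (r (.hyp z D h' C))) (.root (.hyp z D h C))

/-- Moves at an application `MN`. -/
inductive AppMove {Γ Δ : Env} {A B : Ty} {P₁ P₂ : Type} (r₁ : JOcc Γ (.lolli A B) → P₁)
    (r₂ : JOcc Δ A → P₂) (m₁ : P₁ → P₁ → Prop) (m₂ : P₂ → P₂ → Prop) :
    Occ₂ (JOcc (Γ ∪ Δ) B) P₁ P₂ → Occ₂ (JOcc (Γ ∪ Δ) B) P₁ P₂ → Prop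
  | left (o o' : P₁) (h : m₁ o o') : AppMove r₁ r₂ m₁ m₂ (.left o) (.left o')
  | right (o o' : P₂) (h : m₂ o o') : AppMove r₁ r₂ m₁ m₂ (.right o) (.right o')
  | arg_pos (C : Hole A) (hC : C.Pos) :
      AppMove r₁ r₂ m₁ m₂ (.right (r₂ (.goal C))) (.left (r₁ (.goal (.lolliL C))))
  | arg_neg (C : Hole A) (hC : C.Neg) :
      AppMove r₁ r₂ m₁ m₂ (.left (r₁ (.goal (.lolliL C)))) (.right (r₂ (.goal C)))
  | res_pos (C : Hole B) (hC : C.Pos) :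
      AppMove r₁ r₂ m₁ m₂ (.left (r₁ (.goal (.lolliR C)))) (.root (.goal C))
  | res_neg (C : Hole B) (hC : C.Neg) :
      AppMove r₁ r₂ m₁ m₂ (.root (.goal C)) (.left (r₁ (.goal (.lolliR C))))
  | envL_pos (z : ℕ) (D : Ty) (h h') (C : Hole D) (hC : C.Pos) :
      AppMove r₁ r₂ m₁ m₂ (.root (.hyp z D h C)) (.left (r₁ (.hyp z D h' C)))
  | envL_neg (z : ℕ) (D : Ty) (h h') (C : Hole D) (hC : C.Neg) :
      AppMove r₁ r₂ m₁ m₂ (.left (r₁ (.hyp z D h' C))) (.root (.hyp z D h C))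
  | envR_pos (z : ℕ) (D : Ty) (h h') (C : Hole D) (hC : C.Pos) :
      AppMove r₁ r₂ m₁ m₂ (.root (.hyp z D h C)) (.right (r₂ (.hyp z D h' C)))
  | envR_neg (z : ℕ) (D : Ty) (h h') (C : Hole D) (hC : C.Neg) :
      AppMove r₁ r₂ m₁ m₂ (.right (r₂ (.hyp z D h' C))) (.root (.hyp z D h C))

/-- Moves at a pair `M ⊗ N`. -/
inductive TensMove {Γ Δ : Env} {A B : Ty} {P₁ P₂ : Type} (r₁ : JOcc Γ A → P₁)
    (r₂ : JOcc Δ B → P₂) (m₁ : P₁ → P₁ → Prop) (m₂ : P₂ → P₂ → Prop) :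
    Occ₂ (JOcc (Γ ∪ Δ) (.tens A B)) P₁ P₂ → Occ₂ (JOcc (Γ ∪ Δ) (.tens A B)) P₁ P₂ → Prop
  | left (o o' : P₁) (h : m₁ o o') : TensMove r₁ r₂ m₁ m₂ (.left o) (.left o')
  | right (o o' : P₂) (h : m₂ o o') : TensMove r₁ r₂ m₁ m₂ (.right o) (.right o')
  | fst_neg (C : Hole A) (hC : C.Neg) :
      TensMove r₁ r₂ m₁ m₂ (.root (.goal (.tensL C))) (.left (r₁ (.goal C)))
  | fst_pos (C : Hole A) (hC : C.Pos) :
      TensMove r₁ r₂ m₁ m₂ (.left (r₁ (.goal C))) (.root (.goal (.tensL C)))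
  | snd_neg (C : Hole B) (hC : C.Neg) :
      TensMove r₁ r₂ m₁ m₂ (.root (.goal (.tensR C))) (.right (r₂ (.goal C)))
  | snd_pos (C : Hole B) (hC : C.Pos) :
      TensMove r₁ r₂ m₁ m₂ (.right (r₂ (.goal C))) (.root (.goal (.tensR C)))
  | envL_pos (z : ℕ) (D : Ty) (h h') (C : Hole D) (hC : C.Pos) :
      TensMove r₁ r₂ m₁ m₂ (.root (.hyp z D h C)) (.left (r₁ (.hyp z D h' C)))
  | envL_neg (z : ℕ) (D : Ty) (h h') (C : Hole D) (hC : C.Neg) :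
      TensMove r₁ r₂ m₁ m₂ (.left (r₁ (.hyp z D h' C))) (.root (.hyp z D h C))
  | envR_pos (z : ℕ) (D : Ty) (h h') (C : Hole D) (hC : C.Pos) :
      TensMove r₁ r₂ m₁ m₂ (.root (.hyp z D h C)) (.right (r₂ (.hyp z D h' C)))
  | envR_neg (z : ℕ) (D : Ty) (h h') (C : Hole D) (hC : C.Neg) :
      TensMove r₁ r₂ m₁ m₂ (.right (r₂ (.hyp z D h' C))) (.root (.hyp z D h C))

/-- The moves of a single token in a derivation. -/
def Move {𝒰 : Signature} : {Γ : Env} → {M : Term 𝒰} → {A : Ty} → (π : Deriv 𝒰 Γ M A) →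
    Occ π → Occ π → Prop
  | _, _, _, .var x A => VarMove x A
  | _, _, _, .bit _ _ => fun _ _ => False
  | _, _, _, .unitary _ => fun _ _ => False
  | _, _, _, .lam _ _ _ π => LamMove (root π) (Move π)
  | _, _, _, .lamPair _ _ _ _ _ _ _ π => LamPairMove (root π) (Move π)
  | _, _, _, .app _ π ρ => AppMove (root π) (root ρ) (Move π) (Move ρ)
  | _, _, _, .tens _ π ρ => TensMove (root π) (root ρ) (Move π) (Move ρ)

/-! ### Unitary axioms and bit axioms of a derivation -/

/-- An axiom `⊢ U : 𝔹₁ ⊗ ⋯ ⊗ 𝔹ₘ ⊸ 𝔹ₘ₊₁ ⊗ ⋯ ⊗ 𝔹₂ₘ` in a derivation: its symbol, its argument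
occurrences `𝔹₁, …, 𝔹ₘ` and its result occurrences `𝔹ₘ₊₁, …, 𝔹₂ₘ`. -/
structure Gate (𝒰 : Signature) (O : Type) where
  sym : 𝒰.Sym
  arg : Fin (𝒰.arity sym) → O
  res : Fin (𝒰.arity sym) → O

/-- Transport along a map of occurrences. -/
def Gate.map {𝒰 : Signature} {O O' : Type} (f : O → O') (g : Gate 𝒰 O) : Gate 𝒰 O' :=
  ⟨g.sym, fun k => f (g.arg k), fun k => f (g.res k)⟩

/-- All the unitary axioms of a derivation. -/
def gates {𝒰 : Signature} : {Γ : Env} → {M : Term 𝒰} → {A : Ty} → (π : Deriv 𝒰 Γ M A) →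
    List (Gate 𝒰 (Occ π))
  | _, _, _, .var _ _ => []
  | _, _, _, .bit _ _ => []
  | _, _, _, .unitary U =>
      [⟨U, fun k => root (.unitary U) (.goal (.lolliL (Hole.pow _ k))),
        fun k => root (.unitary U) (.goal (.lolliR (Hole.pow _ k)))⟩]
  | _, _, _, .lam x A hx π => (gates π).map (Gate.map (inLam x A hx π))
  | _, _, _, .lamPair x y A B hx hy hxy π =>
      (gates π).map (Gate.map (inLamPair x y A B hx hy hxy π))
  | _, _, _, .app h π ρ =>
      (gates π).map (Gate.map (inAppL h π ρ)) ++ (gates ρ).map (Gate.map (inAppR h π ρ))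
  | _, _, _, .tens h π ρ =>
      (gates π).map (Gate.map (inTensL h π ρ)) ++ (gates ρ).map (Gate.map (inTensR h π ρ))

/-- An axiom `⊢ |b⟩ₙ : 𝔹` in a derivation: its label `n`, its value `b` and its occurrence
of `𝔹`. -/
structure BitLeaf (O : Type) where
  label : ℕ
  val : Bool
  occ : O

/-- Transport along a map of occurrences. -/
def BitLeaf.map {O O' : Type} (f : O → O') (l : BitLeaf O) : BitLeaf O' :=
  ⟨l.label, l.val, f l.occ⟩

/-- All the bit axioms of a derivation, in the order of the derivation. -/
def bitLeaves {𝒰 : Signature} : {Γ : Env} → {M : Term 𝒰} → {A : Ty} → (π : Deriv 𝒰 Γ M A) →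
    List (BitLeaf (Occ π))
  | _, _, _, .var _ _ => []
  | _, _, _, .bit b n => [⟨n, b, root (.bit b n) (.goal .here)⟩]
  | _, _, _, .unitary _ => []
  | _, _, _, .lam x A hx π => (bitLeaves π).map (BitLeaf.map (inLam x A hx π))
  | _, _, _, .lamPair x y A B hx hy hxy π =>
      (bitLeaves π).map (BitLeaf.map (inLamPair x y A B hx hy hxy π))
  | _, _, _, .app h π ρ =>
      (bitLeaves π).map (BitLeaf.map (inAppL h π ρ)) ++ (bitLeaves ρ).map (BitLeaf.map (inAppR h π ρ))
  | _, _, _, .tens h π ρ =>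
      (bitLeaves π).map (BitLeaf.map (inTensL h π ρ)) ++ (bitLeaves ρ).map (BitLeaf.map (inTensR h π ρ))

section Machine

variable {𝒰 : Signature} {Γ : Env} {M : Term 𝒰} {A : Ty}

/-- All the bit axioms of a derivation, in the order of their labels. -/
def sortedBits (π : Deriv 𝒰 Γ M A) : List (BitLeaf (Occ π)) :=
  (bitLeaves π).mergeSort (fun l l' => decide (l.label ≤ l'.label))

/-- The occurrences of sign `s` in the types of `Γ`, in the order of the variables. -/
def envOccs (s : Bool) (Γ : Env) (A : Ty) : List (JOcc Γ A) :=
  (Γ.keys.sort (· ≤ ·)).flatMap fun x =>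
    match h : Γ.lookup x with
    | some B => (holes s B).map (JOcc.hyp x B h)
    | none => []

/-- The negative occurrences in the judgement `Γ ⊢ M : A`, through which tokens enter: the negative
ones of `A` and the positive ones of the types of `Γ`. -/
def inputs (π : Deriv 𝒰 Γ M A) : List (Occ π) :=
  (envOccs true Γ A ++ (holes false A).map JOcc.goal).map (root π)

/-- The positive occurrences in the judgement `Γ ⊢ M : A`, through which tokens leave: the positive
ones of `A` and the negative ones of the types of `Γ`. -/
def outputs (π : Deriv 𝒰 Γ M A) : List (Occ π) :=
  (envOccs false Γ A ++ (holes true A).map JOcc.goal).map (root π)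

/-! ### Quantum registers -/

/-- The Hilbert space `ℂ^{2^n}`. -/
abbrev QSpace (n : ℕ) : Type := EuclideanSpace ℂ (Fin n → Bool)

/-- Quantum registers on `n` qubits: normalised vectors. -/
def Register (n : ℕ) : Type := {v : QSpace n // ‖v‖ = 1}

/-- `U^{i₁,…,iₘ}`: the operator `U` acts on the qubits `i₁, …, iₘ` and leaves the other qubits
unchanged.  Here `Function.extend i c b` is `b` with its entries at `i₁, …, iₘ` replaced by `c`. -/
noncomputable def applyAt {m n : ℕ} (U : Matrix (Fin m → Bool) (Fin m → Bool) ℂ)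
    (i : Fin m ↪ Fin n) (v : QSpace n) : QSpace n :=
  WithLp.toLp 2 fun b => ∑ c : Fin m → Bool, U (b ∘ i) c * v (Function.extend i c b)

/-- The vector `v ⊗ |b⟩`. -/
noncomputable def tensBasis {k l : ℕ} (v : QSpace k) (b : Fin l → Bool) : QSpace (k + l) :=
  WithLp.toLp 2 fun f =>
    v (fun i => f (Fin.castAdd l i)) * if (fun j => f (Fin.natAdd k j)) = b then 1 else 0

/-! ### The token machine -/

/-- States of the token machine of `π` with `n` tokens: a sequence without repetitions of
occurrences of `𝔹` in `π`, and a quantum register on `n` qubits. -/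
structure State (π : Deriv 𝒰 Γ M A) (n : ℕ) where
  occ : Fin n ↪ Occ π
  reg : Register n

/-- The transition relation: a token moves, or a unitary axiom all of whose argument
occurrences carry tokens, those at the positions `i₁, …, iₘ`, fires. -/
inductive Step {π : Deriv 𝒰 Γ M A} {n : ℕ} (S T : State π n) : Prop
  | move (j : Fin n) (hj : Move π (S.occ j) (T.occ j)) (hne : ∀ j', j' ≠ j → T.occ j' = S.occ j')
      (hreg : T.reg = S.reg)
  | fire (g : Gate 𝒰 (Occ π)) (hg : g ∈ gates π) (i : Fin (𝒰.arity g.sym) ↪ Fin n)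
      (harg : ∀ k, S.occ (i k) = g.arg k) (hres : ∀ k, T.occ (i k) = g.res k)
      (hne : ∀ j, j ∉ Set.range i → T.occ j = S.occ j)
      (hreg : T.reg.1 = applyAt (𝒰.op g.sym).1 i S.reg.1)

/-- Reflexive and transitive closure of the transition relation. -/
def Reaches {π : Deriv 𝒰 Γ M A} {n : ℕ} : State π n → State π n → Prop :=
  Relation.ReflTransGen Step

/-- The number of tokens of the machine: the input arity plus the number of bit axioms. -/
abbrev tokens (π : Deriv 𝒰 Γ M A) : ℕ := (inputs π).length + (sortedBits π).length

/-- `S` is the initial state for the register `Q`: the tokens are at the inputs and at the bit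
axioms, and the register is `Q` tensored with the values of the bits. -/
structure IsInitial {π : Deriv 𝒰 Γ M A} (S : State π (tokens π))
    (Q : Register (inputs π).length) : Prop where
  occ_eq : (S.occ : Fin (tokens π) → Occ π) =
    Fin.append (inputs π).get (fun j => ((sortedBits π).get j).occ)
  reg_eq : S.reg.1 = tensBasis Q.1 (fun j => ((sortedBits π).get j).val)

/-- `S` is a final state for `σ`: its sequence of occurrences is the sequence of outputs permuted
by `σ`. -/
def IsFinalFor {π : Deriv 𝒰 Γ M A} {n : ℕ} (S : State π n)
    (σ : Fin n ≃ Fin (outputs π).length) : Prop :=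
  ∀ j, S.occ j = (outputs π).get (σ j)

/-- Final states. -/
def IsFinal {π : Deriv 𝒰 Γ M A} {n : ℕ} (S : State π n) : Prop :=
  ∃ σ, IsFinalFor S σ

/-- The function computed by `π` sends `Q` to `R`: there is an initial state for `Q`, and any such
state rewrites into a final state whose register is `R`, once its qubits are put in the
order of the outputs. -/
def Computes (π : Deriv 𝒰 Γ M A) (Q : Register (inputs π).length)
    (R : Register (outputs π).length) : Prop :=
  (∃ S : State π (tokens π), IsInitial S Q) ∧
  ∀ S : State π (tokens π), IsInitial S Q →
    ∃ (F : State π (tokens π)) (σ : Fin (tokens π) ≃ Fin (outputs π).length),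
      Reaches S F ∧ IsFinalFor F σ ∧ ∀ b : Fin (outputs π).length → Bool, R.1 b = F.reg.1 (b ∘ σ)

end Machine

end QLambda

/-! The proof combines a global fact about the derivation, acyclicity, with a local one, determinism
in both directions.

Acyclicity (`sound`, `wellFounded_edge`). Draw an edge for each possible move and from each argument
to each result of a unitary axiom. A feedback loop could arise only at an application, where tokens
pass back and forth between function and argument, so a plain induction on derivations is too weak.
A logical predicate `Val` strengthens it: a value of type `𝔹` has no dependency, a value of `A ⊗ B`
is a pair of values without cross dependencies, and a value of `A ⊸ B`, connected to any value of
`A`, creates no cycle and yields a value of `B`. A derivation whose variables are assigned values is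
acyclic and induces a value of its type.

Local structure (`full`). Treat moves, unitary axioms and bit axioms as transitions from a set of
occurrences to another, a bit axiom having empty source. Every occurrence is in the source of
exactly one transition unless it is an output, and in the target of exactly one unless it is an
input.

Run. Let `D` be the set of occurrences that tokens have left, and call visited those in `D` or
carrying a token. `Inv` says that each transition has either fired completely or not at all. If all
occurrences are visited, a token off the outputs would be in the source of a transition whose
targets are visited, hence already fired: impossible, so the state is final. Otherwise take an
unvisited occurrence that is minimal for the edges: the transition producing it has only visited
sources, and they all still carry tokens, so it can fire (`Inv.progress`). Each step strictly
enlarges `D` inside a finite set, which gives termination. Registers stay normalised because the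
operators are unitary (`norm_applyAt`). -/

namespace QLambda

open Relation

/-! ### Well-founded relations -/

section Graph

variable {α β I : Type*}

/-- A relation that maps to a well-founded one up to stuttering is well-founded, if stuttering
steps increase a level. -/
theorem wellFounded_of_collapse {r : α → α → Prop} {s : β → β → Prop} (c : α → β) (lev : α → ℕ)
    (hs : WellFounded s)
    (h : ∀ a a', r a a' → s (c a) (c a') ∨ (c a = c a' ∧ lev a < lev a')) : WellFounded r := by
  have hlex : WellFounded (Prod.Lex s (fun m n : ℕ => m < n)) := WellFounded.prod_lex hs Nat.lt_wfRel.wf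
  refine Subrelation.wf ?_ (InvImage.wf (fun a => (c a, lev a)) hlex)
  intro a a' haa'
  rcases h a a' haa' with h1 | ⟨h1, h2⟩
  · exact Prod.Lex.left _ _ h1
  · show Prod.Lex _ _ (c a, lev a) (c a', lev a')
    rw [h1]
    exact Prod.Lex.right _ h2

/-- A path made of stutters alone still raises the level, so two points with the same image and the
same level are joined only by paths with a genuine step. -/
theorem transGen_of_collapse {r : α → α → Prop} {s : β → β → Prop} (c : α → β) (lev : α → ℕ)
    (h : ∀ a a', r a a' → s (c a) (c a') ∨ (c a = c a' ∧ lev a < lev a')) {a a' : α}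
    (haa' : TransGen r a a') : TransGen s (c a) (c a') ∨ (c a = c a' ∧ lev a < lev a') := by
  induction haa' with
  | single h1 => exact (h _ _ h1).imp TransGen.single id
  | tail _ h1 ih =>
    rcases ih with ih | ⟨ih, il⟩ <;> rcases h _ _ h1 with h2 | ⟨h2, hl⟩
    · exact .inl (ih.tail h2)
    · exact .inl (h2 ▸ ih)
    · exact .inl (ih ▸ .single h2)
    · exact .inr ⟨ih.trans h2, il.trans hl⟩

theorem not_transGen_self {r : α → α → Prop} (h : WellFounded r) (a : α) : ¬ TransGen r a a :=
  fun hr => h.transGen.irrefl.irrefl a hr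

/-- Adding edges between ports to a well-founded graph keeps it well-founded if the graph of
reachability between the ports, together with the new edges, is well-founded. -/
theorem wellFounded_of_ports {G K : α → α → Prop} {p : I → α} (hp : p.Injective)
    {K' : I → I → Prop} (hG : WellFounded G)
    (hK : ∀ a b, K a b → ∃ i j, a = p i ∧ b = p j ∧ K' i j)
    (hW : WellFounded fun i j => TransGen G (p i) (p j) ∨ K' i j) :
    WellFounded fun a b => G a b ∨ K a b := by
  have hport : ∀ j, Acc (fun a b => G a b ∨ K a b) (p j) := by
    intro j
    induction j using hW.induction with
    | _ j ih =>
      -- Going backwards from `p j` along old edges, a new edge can be met only at some port `p k`;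
      -- the path from `p k` to `p j` puts `k` below `j`, so the outer induction covers it.
      have hpast : ∀ a, TransGen G a (p j) → Acc (fun a b => G a b ∨ K a b) a := by
        intro a
        induction a using hG.induction with
        | _ a iha =>
          intro ha
          refine ⟨_, fun b hb => ?_⟩
          rcases hb with hb | hb
          · exact iha b hb (ha.head hb)
          · obtain ⟨i, k, rfl, rfl, -⟩ := hK _ _ hb
            exact (ih k (.inl ha)).inv (.inr hb)
      refine ⟨_, fun b hb => ?_⟩
      rcases hb with hb | hb
      · exact hpast b (.single hb)
      · obtain ⟨i, k, rfl, hk, hik⟩ := hK _ _ hb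
        exact ih i (.inr (hp hk ▸ hik))
  refine ⟨fun a => ?_⟩
  induction a using hG.induction with
  | _ a iha =>
    refine ⟨_, fun b hb => ?_⟩
    rcases hb with hb | hb
    · exact iha b hb
    · obtain ⟨i, k, rfl, rfl, -⟩ := hK _ _ hb
      exact hport i

/-- Cut the path at its new edges: the stretches in between are paths of old edges between ports.
Stretches may be empty, so the cutting only gives a reflexive closure, which `i ≠ j` makes proper.
-/
theorem transGen_of_ports {G K : α → α → Prop} {p : I → α} (hp : p.Injective)
    {K' : I → I → Prop} (hK : ∀ a b, K a b → ∃ i j, a = p i ∧ b = p j ∧ K' i j)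
    {i j : I} (hij : TransGen (fun a b => G a b ∨ K a b) (p i) (p j)) (hne : i ≠ j) :
    TransGen (fun i j => TransGen G (p i) (p j) ∨ K' i j) i j := by
  set W : I → I → Prop := fun i j => TransGen G (p i) (p j) ∨ K' i j with hWdef
  have key : ∀ {k l}, ReflTransGen G (p k) (p l) → ReflTransGen W k l := by
    intro k l h
    rcases reflTransGen_iff_eq_or_transGen.1 h with h | h
    · rw [hp h]
    · exact .single (.inl h)
  have main : ∀ c, ReflTransGen (fun a b => G a b ∨ K a b) (p i) c →
      ∃ k, ReflTransGen W i k ∧ ReflTransGen G (p k) c := by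
    intro c hc
    induction hc with
    | refl => exact ⟨i, .refl, .refl⟩
    | tail _ h ih =>
      obtain ⟨k, hk, hkc⟩ := ih
      rcases h with h | h
      · exact ⟨k, hk, hkc.tail h⟩
      · obtain ⟨l, m, rfl, rfl, hlm⟩ := hK _ _ h
        exact ⟨m, (hk.trans (key hkc)).tail (.inr hlm), .refl⟩
  obtain ⟨k, hk, hkc⟩ := main _ hij.to_reflTransGen
  rcases reflTransGen_iff_eq_or_transGen.1 (hk.trans (key hkc)) with h | h
  · exact absurd h.symm hne
  · exact h

theorem wellFounded_liftRel {r : α → α → Prop} {s : β → β → Prop} (hr : WellFounded r)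
    (hs : WellFounded s) : WellFounded (Sum.LiftRel r s) :=
  Subrelation.wf (fun h => Sum.LiftRel.lex h) (Sum.lex_wf hr hs)

theorem transGen_liftRel_inl {r : α → α → Prop} {s : β → β → Prop} {a : α} {x : α ⊕ β}
    (h : TransGen (Sum.LiftRel r s) (.inl a) x) : ∃ a', x = .inl a' ∧ TransGen r a a' := by
  induction h with
  | single h => cases h with | inl h => exact ⟨_, rfl, .single h⟩
  | tail _ h ih =>
    obtain ⟨a', rfl, ha'⟩ := ih
    cases h with | inl h => exact ⟨_, rfl, ha'.tail h⟩

theorem transGen_liftRel_inr {r : α → α → Prop} {s : β → β → Prop} {a : β} {x : α ⊕ β}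
    (h : TransGen (Sum.LiftRel r s) (.inr a) x) : ∃ a', x = .inr a' ∧ TransGen s a a' := by
  induction h with
  | single h => cases h with | inr h => exact ⟨_, rfl, .single h⟩
  | tail _ h ih =>
    obtain ⟨a', rfl, ha'⟩ := ih
    cases h with | inr h => exact ⟨_, rfl, ha'.tail h⟩

end Graph

/-! ### Values: the dependencies between occurrences allowed by a type -/

/-- A dependency relation on the occurrences of the argument of `A ⊸ B`. -/
inductive ArgRel {A B : Ty} (S : Hole A → Hole A → Prop) :
    Hole (.lolli A B) → Hole (.lolli A B) → Prop
  | mk {C C' : Hole A} (h : S C C') : ArgRel S (.lolliL C) (.lolliL C')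

/-- The logical predicate on dependency relations: `R C C'` says that the token leaving at `C'`
depends on the one entering at `C`. -/
def Val : (A : Ty) → (Hole A → Hole A → Prop) → Prop
  | .bit, R => ∀ C C', ¬ R C C'
  | .tens A B, R => (∀ C C', ¬ R (.tensL C) (.tensR C')) ∧ (∀ C C', ¬ R (.tensR C) (.tensL C')) ∧
      Val A (fun C C' => R (.tensL C) (.tensL C')) ∧ Val B (fun C C' => R (.tensR C) (.tensR C'))
  | .lolli A B, R => ∀ S, Val A S → WellFounded (fun C C' => R C C' ∨ ArgRel (B := B) S C C') ∧
      Val B fun C C' => TransGen (fun C C' => R C C' ∨ ArgRel S C C') (.lolliR C) (.lolliR C')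

/-- Every clause of `Val` forbids dependencies, and the quantifier over arguments does not involve
`R`, so removing edges is harmless. -/
theorem Val.mono : ∀ {A : Ty} {R R' : Hole A → Hole A → Prop}, Val A R →
    (∀ C C', R' C C' → R C C') → Val A R'
  | .bit, _, _, h, hs => fun C C' hr => h C C' (hs _ _ hr)
  | .tens _ _, _, _, ⟨h1, h2, h3, h4⟩, hs =>
    ⟨fun _ _ hr => h1 _ _ (hs _ _ hr), fun _ _ hr => h2 _ _ (hs _ _ hr),
      h3.mono fun _ _ => hs _ _, h4.mono fun _ _ => hs _ _⟩
  | .lolli _ _, _, _, h, hs => fun S hS =>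
    ⟨Subrelation.wf (fun hr => hr.imp_left (hs _ _)) (h S hS).1,
      (h S hS).2.mono fun _ _ hr => TransGen.mono (fun _ _ h => h.imp_left (hs _ _)) _ _ hr⟩

/-- The two claims need each other at `A ⊸ B`: to see that `R` is well-founded one must feed it some
value of `A`, here the empty one, and the empty relation is a value because every argument fed to it
is itself well-founded. -/
theorem Val.wellFounded_and_empty : ∀ A : Ty,
    (∀ {R : Hole A → Hole A → Prop}, Val A R → WellFounded R) ∧ Val A (fun _ _ => False)
  | .bit => ⟨fun h => ⟨fun C => ⟨_, fun C' hr => absurd hr (h _ _)⟩⟩, fun _ _ h => h⟩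
  | .tens A B => by
    obtain ⟨hA, eA⟩ := Val.wellFounded_and_empty A
    obtain ⟨hB, eB⟩ := Val.wellFounded_and_empty B
    refine ⟨fun {R} ⟨h1, h2, h3, h4⟩ => ?_, fun _ _ h => h, fun _ _ h => h, eA, eB⟩
    let c : Hole (.tens A B) → Hole A ⊕ Hole B
      | .tensL C => .inl C
      | .tensR C => .inr C
    refine Subrelation.wf (r := InvImage _ c) ?_ (InvImage.wf c (wellFounded_liftRel (hA h3) (hB h4)))
    intro C C' h
    cases C <;> cases C'
    · exact .inl h
    · exact absurd h (h1 _ _)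
    · exact absurd h (h2 _ _)
    · exact .inr h
  | .lolli A B => by
    obtain ⟨hA, eA⟩ := Val.wellFounded_and_empty A
    obtain ⟨hB, eB⟩ := Val.wellFounded_and_empty B
    refine ⟨fun {R} h => Subrelation.wf (fun h => .inl h) (h _ eA).1, fun S hS => ⟨?_, ?_⟩⟩
    · refine ⟨fun C => ?_⟩
      have hL : ∀ C : Hole A, Acc (fun C C' => False ∨ ArgRel (B := B) S C C') (.lolliL C) := by
        intro C
        induction C using (hA hS).induction with
        | _ C ih =>
          refine ⟨_, fun D hD => ?_⟩
          rcases hD with hD | hD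
          · exact hD.elim
          · cases hD with | mk hD => exact ih _ hD
      refine ⟨_, fun D hD => ?_⟩
      rcases hD with hD | hD
      · exact hD.elim
      · cases hD with | mk hD => exact hL _
    -- No edge ends in the result: an argument relation stays on the argument side.
    · refine eB.mono fun C C' h => ?_
      cases h with
      | single h => rcases h with h | h
                    · exact h
                    · nomatch h
      | tail _ h => rcases h with h | h
                    · exact h
                    · nomatch h

theorem Val.wellFounded {A : Ty} {R : Hole A → Hole A → Prop} (h : Val A R) : WellFounded R :=
  (Val.wellFounded_and_empty A).1 h

theorem Val.empty (A : Ty) : Val A fun _ _ => False := (Val.wellFounded_and_empty A).2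

/-- Serves the variable axiom, whose reachability is contained in the transitive closure of the
value assigned to the variable. At `A ⊸ B`, replacing `R` by its closure creates no new path once
the argument is connected. -/
theorem Val.transGen : ∀ {A : Ty} {R : Hole A → Hole A → Prop}, Val A R → Val A (TransGen R)
  | .bit, R, h => fun C C' hr => by
    cases hr with
    | single hr => exact h _ _ hr
    | tail _ hr => exact h _ _ hr
  | .tens A B, R, ⟨h1, h2, h3, h4⟩ => by
    have hL : ∀ C D, TransGen R (.tensL C) D →
        ∃ C', D = .tensL C' ∧ TransGen (fun C C' => R (.tensL C) (.tensL C')) C C' := by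
      intro C D h
      induction h with
      | @single D h =>
        cases D with
        | tensL D => exact ⟨D, rfl, .single h⟩
        | tensR D => exact absurd h (h1 _ _)
      | @tail D E _ h ih =>
        obtain ⟨D, rfl, hD⟩ := ih
        cases E with
        | tensL E => exact ⟨E, rfl, hD.tail h⟩
        | tensR E => exact absurd h (h1 _ _)
    have hR : ∀ C D, TransGen R (.tensR C) D →
        ∃ C', D = .tensR C' ∧ TransGen (fun C C' => R (.tensR C) (.tensR C')) C C' := by
      intro C D h
      induction h with
      | @single D h =>
        cases D with
        | tensR D => exact ⟨D, rfl, .single h⟩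
        | tensL D => exact absurd h (h2 _ _)
      | @tail D E _ h ih =>
        obtain ⟨D, rfl, hD⟩ := ih
        cases E with
        | tensR E => exact ⟨E, rfl, hD.tail h⟩
        | tensL E => exact absurd h (h2 _ _)
    refine ⟨fun C C' h => ?_, fun C C' h => ?_, h3.transGen.mono fun C C' h => ?_,
      h4.transGen.mono fun C C' h => ?_⟩
    · obtain ⟨_, h, -⟩ := hL _ _ h
      cases h
    · obtain ⟨_, h, -⟩ := hR _ _ h
      cases h
    · obtain ⟨_, h, h'⟩ := hL _ _ h
      cases h
      exact h'
    · obtain ⟨_, h, h'⟩ := hR _ _ h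
      cases h
      exact h'
  | .lolli A B, R, h => fun S hS => by
    have key : ∀ C C', (TransGen R C C' ∨ ArgRel (B := B) S C C') →
        TransGen (fun C C' => R C C' ∨ ArgRel S C C') C C' := by
      rintro C C' (h | h)
      · exact TransGen.mono (fun _ _ => .inl) _ _ h
      · exact .single (.inr h)
    exact ⟨Subrelation.wf (fun h => key _ _ h) (h S hS).1.transGen,
      (h S hS).2.mono fun C C' h => TransGen.trans_induction_on h (fun h => key _ _ h)
        fun _ _ h1 h2 => h1.trans h2⟩

/-! ### The wiring of a typing rule -/

/-- Whether tokens enter a derivation through an occurrence in its concluding judgement. -/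
def JOcc.entry {Γ : Env} {A : Ty} : JOcc Γ A → Bool
  | .hyp _ _ _ C => C.sign
  | .goal C => !C.sign

/-- The moves between the occurrences of a concluding judgement, the ports `J`, and those of the
premises, the ports `JP`.  The map `φ` sends an occurrence of the conclusion to the corresponding
one in a premise, and `κ` relates the occurrences in the cut formula. -/
inductive Link {J P JP O : Type} (e : J ⊕ P ≃ O) (ent : J → Bool) (r : JP → P) (φ : J → JP)
    (κ : JP → JP → Prop) : O → O → Prop
  | up (j : J) (h : ent j = true) : Link e ent r φ κ (e (.inl j)) (e (.inr (r (φ j))))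
  | down (j : J) (h : ent j = false) : Link e ent r φ κ (e (.inr (r (φ j)))) (e (.inl j))
  | cut (a b : JP) (h : κ a b) : Link e ent r φ κ (e (.inr (r a))) (e (.inr (r b)))

/-- The constructor with its end points left free, so that concrete occurrences can be matched by
separate equations; likewise for the next two. -/
theorem Link.of_up {J P JP O : Type} {e : J ⊕ P ≃ O} {ent : J → Bool} {r : JP → P} {φ : J → JP}
    {κ : JP → JP → Prop} {o o' : O} (j : J) (h : ent j = true) (ho : e (.inl j) = o)
    (ho' : e (.inr (r (φ j))) = o') : Link e ent r φ κ o o' := by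
  subst ho ho'
  exact .up j h

theorem Link.of_down {J P JP O : Type} {e : J ⊕ P ≃ O} {ent : J → Bool} {r : JP → P} {φ : J → JP}
    {κ : JP → JP → Prop} {o o' : O} (j : J) (h : ent j = false) (ho : e (.inr (r (φ j))) = o)
    (ho' : e (.inl j) = o') : Link e ent r φ κ o o' := by
  subst ho ho'
  exact .down j h

theorem Link.of_cut {J P JP O : Type} {e : J ⊕ P ≃ O} {ent : J → Bool} {r : JP → P} {φ : J → JP}
    {κ : JP → JP → Prop} {o o' : O} (a b : JP) (h : κ a b) (ho : e (.inr (r a)) = o)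
    (ho' : e (.inr (r b)) = o') : Link e ent r φ κ o o' := by
  subst ho ho'
  exact .cut a b h

/-- The combinatorial content of a typing rule: each port of a premise either corresponds to exactly
one port of the conclusion, with the same direction, or is an end of exactly one cut edge, and cut
edges lead from an exit to an entry. -/
structure Wiring {J JP : Type} (ent : J → Bool) (entP : JP → Bool) (φ : J → JP)
    (κ : JP → JP → Prop) : Prop where
  inj : φ.Injective
  ent_eq : ∀ j, entP (φ j) = ent j
  left : ∀ {a b}, κ a b → entP a = false
  right : ∀ {a b}, κ a b → entP b = true
  left_unique : ∀ {a a' b}, κ a b → κ a' b → a = a'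
  right_unique : ∀ {a b b'}, κ a b → κ a b' → b = b'
  ne : ∀ {a b}, κ a b → ∀ j, φ j ≠ a ∧ φ j ≠ b
  total : ∀ a, (∃ j, φ j = a) ∨ (∃ b, κ a b) ∨ ∃ b, κ b a

/-- Reversing all moves exchanges entries and exits. Statements about incoming transitions thus
follow from those about outgoing ones. -/
theorem Wiring.swap {J JP : Type} {ent : J → Bool} {entP : JP → Bool} {φ : J → JP}
    {κ : JP → JP → Prop} (h : Wiring ent entP φ κ) :
    Wiring (fun j => !ent j) (fun a => !entP a) φ (Function.swap κ) where
  inj := h.inj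
  ent_eq j := by rw [h.ent_eq]
  left hk := by rw [h.right hk]; rfl
  right hk := by rw [h.left hk]; rfl
  left_unique h1 h2 := h.right_unique h1 h2
  right_unique h1 h2 := h.left_unique h1 h2
  ne hk j := (h.ne hk j).symm
  total a := (h.total a).imp_right Or.symm

theorem Wiring.of_bijective {J JP : Type} {ent : J → Bool} {entP : JP → Bool} {φ : J → JP}
    (hφ : φ.Bijective) (he : ∀ j, entP (φ j) = ent j) :
    Wiring ent entP φ (fun _ _ => False) where
  inj := hφ.1
  ent_eq := he
  left := False.elim
  right := False.elim
  left_unique := False.elim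
  right_unique := False.elim
  ne := False.elim
  total a := .inl (hφ.2 a)

/-- Contracting the links of a rule without cutting its premises. -/
theorem Link.collapse {J P JP O : Type} {e : J ⊕ P ≃ O} {ent : J → Bool} {r : JP → P} {φ : J → JP}
    {κ : JP → JP → Prop} (hr : r.Injective) (hφ : φ.Injective) {E : O → O → Prop}
    {EP : P → P → Prop}
    (hE : ∀ o o', E o o' → (∃ p p', EP p p' ∧ e (.inr p) = o ∧ e (.inr p') = o') ∨
      Link e ent r φ κ o o' ∨
      ∃ j j', EP (r (φ j)) (r (φ j')) ∧ e (.inl j) = o ∧ e (.inl j') = o')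
    (hH : WellFounded fun p p' => EP p p' ∨ ∃ a b, p = r a ∧ p' = r b ∧ κ a b) :
    WellFounded E ∧ ∀ j j', TransGen E (e (.inl j)) (e (.inl j')) →
      TransGen (fun p p' => EP p p' ∨ ∃ a b, p = r a ∧ p' = r b ∧ κ a b) (r (φ j)) (r (φ j')) := by
  let c : O → P := fun o => Sum.elim (r ∘ φ) id (e.symm o)
  -- Each port of the conclusion is contracted to its copy in a premise. The levels 0 for entries, 1
  -- for the premises and 2 for exits make every contracted link, upward or downward, increase the
  -- level.
  let lev : O → ℕ := fun o => Sum.elim (fun j => if ent j then 0 else 2) (fun _ => 1) (e.symm o)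
  have key : ∀ o o', E o o' → (EP (c o) (c o') ∨ ∃ a b, c o = r a ∧ c o' = r b ∧ κ a b) ∨
      (c o = c o' ∧ lev o < lev o') := by
    intro o o' h
    replace h := hE o o' h
    rcases h with ⟨p, p', h, rfl, rfl⟩ | h | ⟨j, j', h, rfl, rfl⟩
    · exact .inl (.inl (by simpa [c] using h))
    · cases h with
      | up j h => exact .inr (by simp [c, lev, h])
      | down j h => exact .inr (by simp [c, lev, h])
      | cut a b h => exact .inl (.inr ⟨a, b, by simp [c], by simp [c], h⟩)
    · exact .inl (.inl (by simpa [c] using h))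
  refine ⟨wellFounded_of_collapse c lev hH key, fun j j' h => ?_⟩
  rcases transGen_of_collapse (s := fun p p' => EP p p' ∨ ∃ a b, p = r a ∧ p' = r b ∧ κ a b)
    c lev key h with h | ⟨h, hl⟩
  · simpa only [c, Equiv.symm_apply_apply, Sum.elim_inl, Function.comp_apply] using h
  · simp only [c, Equiv.symm_apply_apply, Sum.elim_inl, Function.comp_apply] at h
    -- A path of stutters would join a port to itself while raising its level.
    rw [hφ (hr h)] at hl
    exact absurd hl (lt_irrefl _)

/-- The occurrences of a derivation with one premise. -/
def Occ₁.equiv (J P : Type) : J ⊕ P ≃ Occ₁ J P where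
  toFun := Sum.elim .root .prem
  invFun | .root j => .inl j | .prem p => .inr p
  left_inv := by rintro (_ | _) <;> rfl
  right_inv := by rintro (_ | _) <;> rfl

/-- The occurrences of a derivation with two premises. -/
def Occ₂.equiv (J P₁ P₂ : Type) : J ⊕ (P₁ ⊕ P₂) ≃ Occ₂ J P₁ P₂ where
  toFun := Sum.elim .root (Sum.elim .left .right)
  invFun | .root j => .inl j | .left p => .inr (.inl p) | .right p => .inr (.inr p)
  left_inv := by rintro (_ | _ | _) <;> rfl
  right_inv := by rintro (_ | _ | _) <;> rfl

section Rules

variable {Γ Δ : Env} {A B E : Ty} {x y : ℕ}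

/-! ### Abstraction -/

def lamPort (hx : x ∉ Γ) : JOcc Γ (.lolli A B) → JOcc (Γ.insert x A) B
  | .hyp z D h C => .hyp z D (by
      rw [Finmap.lookup_insert_of_ne _ (by
        rintro rfl; exact hx (Finmap.mem_of_lookup_eq_some h))]; exact h) C
  | .goal (.lolliL C) => .hyp x A (Finmap.lookup_insert _) C
  | .goal (.lolliR C) => .goal C

theorem lamPort_wiring (hx : x ∉ Γ) : Wiring (JOcc.entry (Γ := Γ) (A := .lolli A B)) JOcc.entry
    (lamPort hx) (fun _ _ => False) := by
  have hne : ∀ {z D}, Γ.lookup z = some D → z ≠ x := by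
    rintro z D h rfl; exact hx (Finmap.mem_of_lookup_eq_some h)
  refine .of_bijective ⟨?_, ?_⟩ ?_
  · rintro (⟨z, D, h, C⟩ | (⟨C⟩ | ⟨C⟩)) (⟨z', D', h', C'⟩ | (⟨C'⟩ | ⟨C'⟩)) heq <;>
      simp only [lamPort, JOcc.hyp.injEq, JOcc.goal.injEq, reduceCtorEq] at heq
    · obtain ⟨rfl, rfl, heq⟩ := heq
      rw [eq_of_heq heq]
    · exact absurd heq.1 (hne h)
    · exact absurd heq.1.symm (hne h')
    · rw [eq_of_heq heq.2.2]
    · rw [heq]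
  · rintro (⟨z, D, h, C⟩ | C)
    · by_cases hz : z = x
      · subst hz
        obtain rfl : A = D := by simpa using h
        exact ⟨.goal (.lolliL C), rfl⟩
      · exact ⟨.hyp z D (by rwa [Finmap.lookup_insert_of_ne _ hz] at h) C, rfl⟩
    · exact ⟨.goal (.lolliR C), rfl⟩
  · rintro (⟨z, D, h, C⟩ | (⟨C⟩ | ⟨C⟩)) <;> simp [lamPort, JOcc.entry, Hole.sign]

/-- Puts the moves of the rule in the common form "moves of the premises or links of the wiring".
The later arguments about wirings then apply to every rule with premises. -/
theorem lamMove_iff {P : Type} (hx : x ∉ Γ) (r : JOcc (Γ.insert x A) B → P) (m : P → P → Prop)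
    (o o' : Occ₁ (JOcc Γ (.lolli A B)) P) :
    LamMove r m o o' ↔ (∃ p p', m p p' ∧ Occ₁.equiv _ _ (.inr p) = o ∧
      Occ₁.equiv _ _ (.inr p') = o') ∨
      Link (Occ₁.equiv _ _) JOcc.entry r (lamPort hx) (fun _ _ => False) o o' := by
  constructor
  · intro h
    cases h with
    | prem o o' h => exact .inl ⟨o, o', h, rfl, rfl⟩
    | arg_neg C h hC =>
      exact .inr (.of_down (.goal (.lolliL C)) (by simpa [JOcc.entry, Hole.sign, Hole.Pos, Hole.Neg] using hC) rfl rfl)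
    | arg_pos C h hC =>
      exact .inr (.of_up (.goal (.lolliL C)) (by simpa [JOcc.entry, Hole.sign, Hole.Pos, Hole.Neg] using hC) rfl rfl)
    | body_pos C hC =>
      exact .inr (.of_down (.goal (.lolliR C)) (by simpa [JOcc.entry, Hole.sign, Hole.Pos, Hole.Neg] using hC) rfl rfl)
    | body_neg C hC =>
      exact .inr (.of_up (.goal (.lolliR C)) (by simpa [JOcc.entry, Hole.sign, Hole.Pos, Hole.Neg] using hC) rfl rfl)
    | env_pos z D h h' C hC => exact .inr (.of_up (.hyp z D h C) hC rfl rfl)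
    | env_neg z D h h' C hC => exact .inr (.of_down (.hyp z D h C) hC rfl rfl)
  · rintro (⟨p, p', h, rfl, rfl⟩ | h)
    · exact .prem _ _ h
    · cases h with
      | up j h =>
        rcases j with (⟨z, D, h', C⟩ | (⟨C⟩ | ⟨C⟩)) <;> simp [JOcc.entry, Hole.sign] at h
        · exact .env_pos _ _ _ _ _ h
        · exact .arg_pos _ _ h
        · exact .body_neg _ h
      | down j h =>
        rcases j with (⟨z, D, h', C⟩ | (⟨C⟩ | ⟨C⟩)) <;> simp [JOcc.entry, Hole.sign] at h
        · exact .env_neg _ _ _ _ _ h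
        · exact .arg_neg _ _ h
        · exact .body_pos _ h
      | cut _ _ h => exact h.elim

/-! ### Abstraction of a pair -/

theorem lookup_insert₂ (hx : x ∉ Γ) (hy : y ∉ Γ) {z : ℕ} {D : Ty} (h : Γ.lookup z = some D) :
    ((Γ.insert x A).insert y B).lookup z = some D := by
  have hne : ∀ {w : ℕ}, w ∉ Γ → z ≠ w := by
    rintro _ hw rfl; exact hw (Finmap.mem_of_lookup_eq_some h)
  rw [Finmap.lookup_insert_of_ne _ (hne hy), Finmap.lookup_insert_of_ne _ (hne hx), h]

theorem lookup_insert_fst (hxy : x ≠ y) :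
    ((Γ.insert x A).insert y B).lookup x = some A := by
  rw [Finmap.lookup_insert_of_ne _ hxy, Finmap.lookup_insert]

def lamPairPort (hx : x ∉ Γ) (hy : y ∉ Γ) (hxy : x ≠ y) :
    JOcc Γ (.lolli (.tens A B) E) → JOcc ((Γ.insert x A).insert y B) E
  | .hyp z D h C => .hyp z D (lookup_insert₂ hx hy h) C
  | .goal (.lolliL (.tensL C)) => .hyp x A (lookup_insert_fst hxy) C
  | .goal (.lolliL (.tensR C)) => .hyp y B (Finmap.lookup_insert _) C
  | .goal (.lolliR C) => .goal C

/-- Case analysis that opens the tensor on the argument side at once, matching the clauses of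
`lamPairPort`. -/
theorem JOcc.pairCases {motive : JOcc Γ (.lolli (.tens A B) E) → Prop}
    (hyp : ∀ z D h C, motive (.hyp z D h C)) (fst : ∀ C, motive (.goal (.lolliL (.tensL C))))
    (snd : ∀ C, motive (.goal (.lolliL (.tensR C)))) (body : ∀ C, motive (.goal (.lolliR C))) :
    ∀ j, motive j
  | .hyp z D h C => hyp z D h C
  | .goal (.lolliL (.tensL C)) => fst C
  | .goal (.lolliL (.tensR C)) => snd C
  | .goal (.lolliR C) => body C

theorem lamPairPort_wiring (hx : x ∉ Γ) (hy : y ∉ Γ) (hxy : x ≠ y) :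
    Wiring (JOcc.entry (Γ := Γ) (A := .lolli (.tens A B) E)) JOcc.entry
    (lamPairPort hx hy hxy) (fun _ _ => False) := by
  have hne : ∀ {z D w}, w ∉ Γ → Γ.lookup z = some D → z ≠ w := by
    rintro z D _ hw h rfl; exact hw (Finmap.mem_of_lookup_eq_some h)
  refine .of_bijective ⟨?_, ?_⟩ ?_
  · intro j j' heq
    cases j using JOcc.pairCases <;> cases j' using JOcc.pairCases <;>
      simp only [lamPairPort, JOcc.hyp.injEq, JOcc.goal.injEq, reduceCtorEq] at heq
    · obtain ⟨rfl, rfl, heq⟩ := heq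
      rw [eq_of_heq heq]
    · rename_i h _ _
      exact absurd heq.1 (hne hx h)
    · rename_i h _ _
      exact absurd heq.1 (hne hy h)
    · rename_i h _
      exact absurd heq.1.symm (hne hx h)
    · rw [eq_of_heq heq.2.2]
    · exact absurd heq.1 hxy
    · rename_i h _
      exact absurd heq.1.symm (hne hy h)
    · exact absurd heq.1.symm hxy
    · rw [eq_of_heq heq.2.2]
    · rw [heq]
  · rintro (⟨z, D, h, C⟩ | C)
    · by_cases hz : z = y
      · subst hz
        obtain rfl : B = D := by simpa using h
        exact ⟨.goal (.lolliL (.tensR C)), rfl⟩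
      · by_cases hz' : z = x
        · subst hz'
          obtain rfl : A = D := by simpa [Finmap.lookup_insert_of_ne _ hz] using h
          exact ⟨.goal (.lolliL (.tensL C)), rfl⟩
        · exact ⟨.hyp z D (by
            rwa [Finmap.lookup_insert_of_ne _ hz, Finmap.lookup_insert_of_ne _ hz'] at h) C, rfl⟩
    · exact ⟨.goal (.lolliR C), rfl⟩
  · intro j
    cases j using JOcc.pairCases <;> simp [lamPairPort, JOcc.entry, Hole.sign]

theorem lamPairMove_iff {P : Type} (hx : x ∉ Γ) (hy : y ∉ Γ) (hxy : x ≠ y)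
    (r : JOcc ((Γ.insert x A).insert y B) E → P) (m : P → P → Prop)
    (o o' : Occ₁ (JOcc Γ (.lolli (.tens A B) E)) P) :
    LamPairMove r m o o' ↔ (∃ p p', m p p' ∧ Occ₁.equiv _ _ (.inr p) = o ∧
      Occ₁.equiv _ _ (.inr p') = o') ∨
      Link (Occ₁.equiv _ _) JOcc.entry r (lamPairPort hx hy hxy) (fun _ _ => False) o o' := by
  constructor
  · intro h
    cases h with
    | prem o o' h => exact .inl ⟨o, o', h, rfl, rfl⟩
    | fst_neg C h hC =>
      exact .inr (.of_down (.goal (.lolliL (.tensL C))) (by simpa [JOcc.entry, Hole.sign, Hole.Pos, Hole.Neg] using hC) rfl rfl)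
    | fst_pos C h hC =>
      exact .inr (.of_up (.goal (.lolliL (.tensL C))) (by simpa [JOcc.entry, Hole.sign, Hole.Pos, Hole.Neg] using hC) rfl rfl)
    | snd_neg C h hC =>
      exact .inr (.of_down (.goal (.lolliL (.tensR C))) (by simpa [JOcc.entry, Hole.sign, Hole.Pos, Hole.Neg] using hC) rfl rfl)
    | snd_pos C h hC =>
      exact .inr (.of_up (.goal (.lolliL (.tensR C))) (by simpa [JOcc.entry, Hole.sign, Hole.Pos, Hole.Neg] using hC) rfl rfl)
    | body_pos C hC =>
      exact .inr (.of_down (.goal (.lolliR C)) (by simpa [JOcc.entry, Hole.sign, Hole.Pos, Hole.Neg] using hC) rfl rfl)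
    | body_neg C hC =>
      exact .inr (.of_up (.goal (.lolliR C)) (by simpa [JOcc.entry, Hole.sign, Hole.Pos, Hole.Neg] using hC) rfl rfl)
    | env_pos z D h h' C hC => exact .inr (.of_up (.hyp z D h C) hC rfl rfl)
    | env_neg z D h h' C hC => exact .inr (.of_down (.hyp z D h C) hC rfl rfl)
  · rintro (⟨p, p', h, rfl, rfl⟩ | h)
    · exact .prem _ _ h
    · cases h with
      | up j h =>
        cases j using JOcc.pairCases <;> simp [JOcc.entry, Hole.sign] at h
        · exact .env_pos _ _ _ _ _ h
        · exact .fst_pos _ _ h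
        · exact .snd_pos _ _ h
        · exact .body_neg _ h
      | down j h =>
        cases j using JOcc.pairCases <;> simp [JOcc.entry, Hole.sign] at h
        · exact .env_neg _ _ _ _ _ h
        · exact .fst_neg _ _ h
        · exact .snd_neg _ _ h
        · exact .body_pos _ h
      | cut _ _ h => exact h.elim

/-! ### Pairs and applications -/

theorem lookup_union_left' {z : ℕ} (hz : z ∈ Γ) {D : Ty} (h : (Γ ∪ Δ).lookup z = some D) :
    Γ.lookup z = some D := by
  rwa [Finmap.lookup_union_left hz] at h

theorem lookup_union_right' {z : ℕ} (hz : z ∉ Γ) {D : Ty} (h : (Γ ∪ Δ).lookup z = some D) :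
    Δ.lookup z = some D := by
  rwa [Finmap.lookup_union_right hz] at h

/-- The occurrence in the environment of a premise corresponding to one in `Γ ∪ Δ`. -/
def envPort (A B : Ty) (z : ℕ) (D : Ty) (h : (Γ ∪ Δ).lookup z = some D) (C : Hole D) :
    JOcc Γ A ⊕ JOcc Δ B :=
  if hz : z ∈ Γ then .inl (.hyp z D (lookup_union_left' hz h) C)
  else .inr (.hyp z D (lookup_union_right' hz h) C)

theorem envPort_left {z : ℕ} {D : Ty} (h : (Γ ∪ Δ).lookup z = some D)
    (h' : Γ.lookup z = some D) (C : Hole D) : envPort A B z D h C = .inl (.hyp z D h' C) :=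
  dif_pos (Finmap.mem_of_lookup_eq_some h')

theorem envPort_right (hΓΔ : Γ.Disjoint Δ) {z : ℕ} {D : Ty} (h : (Γ ∪ Δ).lookup z = some D)
    (h' : Δ.lookup z = some D) (C : Hole D) : envPort A B z D h C = .inr (.hyp z D h' C) :=
  dif_neg fun hz => hΓΔ z hz (Finmap.mem_of_lookup_eq_some h')

theorem lookup_union_of_left {z : ℕ} {D : Ty} (h : Γ.lookup z = some D) :
    (Γ ∪ Δ).lookup z = some D := by
  rwa [Finmap.lookup_union_left (Finmap.mem_of_lookup_eq_some h)]

theorem lookup_union_of_right (hΓΔ : Γ.Disjoint Δ) {z : ℕ} {D : Ty} (h : Δ.lookup z = some D) :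
    (Γ ∪ Δ).lookup z = some D := by
  rwa [Finmap.lookup_union_right fun hz => hΓΔ z hz (Finmap.mem_of_lookup_eq_some h)]

theorem envPort_inj {z z' : ℕ} {D D' : Ty} {h : (Γ ∪ Δ).lookup z = some D} {h'} {C : Hole D}
    {C' : Hole D'} (heq : envPort A B z D h C = envPort A B z' D' h' C') :
    (JOcc.hyp z D h C : JOcc (Γ ∪ Δ) E) = .hyp z' D' h' C' := by
  unfold envPort at heq
  split_ifs at heq <;> simp only [Sum.inl.injEq, Sum.inr.injEq, JOcc.hyp.injEq] at heq <;>
  · obtain ⟨rfl, rfl, heq⟩ := heq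
    rw [eq_of_heq heq]

theorem envPort_entry {z : ℕ} {D : Ty} (h : (Γ ∪ Δ).lookup z = some D) (C : Hole D) :
    Sum.elim JOcc.entry JOcc.entry (envPort A B z D h C) = C.sign := by
  unfold envPort
  split_ifs <;> rfl

theorem envPort_ne_inl {z : ℕ} {D : Ty} (h : (Γ ∪ Δ).lookup z = some D) (C : Hole D) (C' : Hole A) :
    envPort A B z D h C ≠ .inl (.goal C') := by
  unfold envPort
  split_ifs <;> simp

theorem envPort_ne_inr {z : ℕ} {D : Ty} (h : (Γ ∪ Δ).lookup z = some D) (C : Hole D) (C' : Hole B) :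
    envPort A B z D h C ≠ .inr (.goal C') := by
  unfold envPort
  split_ifs <;> simp

def tensPort : JOcc (Γ ∪ Δ) (.tens A B) → JOcc Γ A ⊕ JOcc Δ B
  | .hyp z D h C => envPort A B z D h C
  | .goal (.tensL C) => .inl (.goal C)
  | .goal (.tensR C) => .inr (.goal C)

theorem tensPort_wiring (hΓΔ : Γ.Disjoint Δ) : Wiring (JOcc.entry (Γ := Γ ∪ Δ) (A := .tens A B))
    (Sum.elim JOcc.entry JOcc.entry) tensPort (fun _ _ => False) := by
  refine .of_bijective ⟨?_, ?_⟩ ?_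
  · rintro (⟨z, D, h, C⟩ | (⟨C⟩ | ⟨C⟩)) (⟨z', D', h', C'⟩ | (⟨C'⟩ | ⟨C'⟩)) heq <;>
      simp only [tensPort] at heq
    · exact envPort_inj heq
    · exact absurd heq (envPort_ne_inl _ _ _)
    · exact absurd heq (envPort_ne_inr _ _ _)
    · exact absurd heq.symm (envPort_ne_inl _ _ _)
    · cases heq; rfl
    · cases heq
    · exact absurd heq.symm (envPort_ne_inr _ _ _)
    · cases heq
    · cases heq; rfl
  · rintro ((⟨z, D, h, C⟩ | C) | (⟨z, D, h, C⟩ | C))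
    · exact ⟨.hyp z D (lookup_union_of_left h) C, envPort_left (lookup_union_of_left h) h C⟩
    · exact ⟨.goal (.tensL C), rfl⟩
    · exact ⟨.hyp z D (lookup_union_of_right hΓΔ h) C, envPort_right hΓΔ (lookup_union_of_right hΓΔ h) h C⟩
    · exact ⟨.goal (.tensR C), rfl⟩
  · rintro (⟨z, D, h, C⟩ | (⟨C⟩ | ⟨C⟩))
    · exact envPort_entry h C
    · rfl
    · rfl

theorem tensMove_iff {P₁ P₂ : Type} (hΓΔ : Γ.Disjoint Δ) (r₁ : JOcc Γ A → P₁) (r₂ : JOcc Δ B → P₂)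
    (m₁ : P₁ → P₁ → Prop) (m₂ : P₂ → P₂ → Prop) (o o' : Occ₂ (JOcc (Γ ∪ Δ) (.tens A B)) P₁ P₂) :
    TensMove r₁ r₂ m₁ m₂ o o' ↔ (∃ p p', Sum.LiftRel m₁ m₂ p p' ∧ Occ₂.equiv _ _ _ (.inr p) = o ∧
      Occ₂.equiv _ _ _ (.inr p') = o') ∨
      Link (Occ₂.equiv _ _ _) JOcc.entry (Sum.map r₁ r₂) tensPort (fun _ _ => False) o o' := by
  constructor
  · intro h
    cases h with
    | left o o' h => exact .inl ⟨_, _, .inl h, rfl, rfl⟩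
    | right o o' h => exact .inl ⟨_, _, .inr h, rfl, rfl⟩
    | fst_neg C hC =>
      exact .inr (.of_up (.goal (.tensL C)) (by simpa [JOcc.entry, Hole.sign, Hole.Pos, Hole.Neg] using hC) rfl rfl)
    | fst_pos C hC =>
      exact .inr (.of_down (.goal (.tensL C)) (by simpa [JOcc.entry, Hole.sign, Hole.Pos, Hole.Neg] using hC) rfl rfl)
    | snd_neg C hC =>
      exact .inr (.of_up (.goal (.tensR C)) (by simpa [JOcc.entry, Hole.sign, Hole.Pos, Hole.Neg] using hC) rfl rfl)
    | snd_pos C hC =>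
      exact .inr (.of_down (.goal (.tensR C)) (by simpa [JOcc.entry, Hole.sign, Hole.Pos, Hole.Neg] using hC) rfl rfl)
    | envL_pos z D h h' C hC =>
      exact .inr (.of_up (.hyp z D h C) hC rfl (by rw [tensPort, envPort_left h h']; rfl))
    | envL_neg z D h h' C hC =>
      exact .inr (.of_down (.hyp z D h C) hC (by rw [tensPort, envPort_left h h']; rfl) rfl)
    | envR_pos z D h h' C hC =>
      exact .inr (.of_up (.hyp z D h C) hC rfl (by rw [tensPort, envPort_right hΓΔ h h']; rfl))
    | envR_neg z D h h' C hC =>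
      exact .inr (.of_down (.hyp z D h C) hC (by rw [tensPort, envPort_right hΓΔ h h']; rfl) rfl)
  · rintro (⟨p, p', h, rfl, rfl⟩ | h)
    · cases h with
      | inl h => exact .left _ _ h
      | inr h => exact .right _ _ h
    · cases h with
      | up j h =>
        rcases j with (⟨z, D, h', C⟩ | (⟨C⟩ | ⟨C⟩)) <;> simp [JOcc.entry, Hole.sign] at h
        · by_cases hz : z ∈ Γ
          · rw [tensPort, envPort_left h' (lookup_union_left' hz h')]
            exact .envL_pos _ _ _ _ _ h
          · rw [tensPort, envPort_right hΓΔ h' (lookup_union_right' hz h')]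
            exact .envR_pos _ _ _ _ _ h
        · exact .fst_neg _ h
        · exact .snd_neg _ h
      | down j h =>
        rcases j with (⟨z, D, h', C⟩ | (⟨C⟩ | ⟨C⟩)) <;> simp [JOcc.entry, Hole.sign] at h
        · by_cases hz : z ∈ Γ
          · rw [tensPort, envPort_left h' (lookup_union_left' hz h')]
            exact .envL_neg _ _ _ _ _ h
          · rw [tensPort, envPort_right hΓΔ h' (lookup_union_right' hz h')]
            exact .envR_neg _ _ _ _ _ h
        · exact .fst_pos _ h
        · exact .snd_pos _ h
      | cut _ _ h => exact h.elim

def appPort : JOcc (Γ ∪ Δ) B → JOcc Γ (.lolli A B) ⊕ JOcc Δ A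
  | .hyp z D h C => envPort (.lolli A B) A z D h C
  | .goal C => .inl (.goal (.lolliR C))

/-- The moves between the two copies of the argument type of an application. -/
inductive AppCut (Γ Δ : Env) (A B : Ty) : JOcc Γ (.lolli A B) ⊕ JOcc Δ A →
    JOcc Γ (.lolli A B) ⊕ JOcc Δ A → Prop
  | pos (C : Hole A) (hC : C.Pos) : AppCut Γ Δ A B (.inr (.goal C)) (.inl (.goal (.lolliL C)))
  | neg (C : Hole A) (hC : C.Neg) : AppCut Γ Δ A B (.inl (.goal (.lolliL C))) (.inr (.goal C))

/-- The only rule with a cut. A positive occurrence of `A` is an exit of the argument and, its sign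
being reversed on the left of `⊸`, an entry of the function; a negative one is the opposite. The
sign therefore decides on which side of a cut edge a port lies. -/
theorem appPort_wiring (hΓΔ : Γ.Disjoint Δ) : Wiring (JOcc.entry (Γ := Γ ∪ Δ) (A := B))
    (Sum.elim JOcc.entry JOcc.entry) appPort (AppCut Γ Δ A B) where
  inj := by
    rintro (⟨z, D, h, C⟩ | C) (⟨z', D', h', C'⟩ | C') heq <;> simp only [appPort] at heq
    · exact envPort_inj heq
    · exact absurd heq (envPort_ne_inl _ _ _)
    · exact absurd heq.symm (envPort_ne_inl _ _ _)
    · cases heq; rfl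
  ent_eq := by
    rintro (⟨z, D, h, C⟩ | C)
    · exact envPort_entry h C
    · rfl
  left := by
    rintro _ _ (⟨C, hC⟩ | ⟨C, hC⟩)
    · simpa [JOcc.entry, Hole.sign, Hole.Pos, Hole.Neg] using hC
    · simpa [JOcc.entry, Hole.sign, Hole.Pos, Hole.Neg] using hC
  right := by
    rintro _ _ (⟨C, hC⟩ | ⟨C, hC⟩)
    · simpa [JOcc.entry, Hole.sign, Hole.Pos, Hole.Neg] using hC
    · simpa [JOcc.entry, Hole.sign, Hole.Pos, Hole.Neg] using hC
  left_unique := by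
    intro a a' b h h'
    cases h <;> cases h' <;> rfl
  right_unique := by
    intro a a' b h h'
    cases h <;> cases h' <;> rfl
  ne := by
    intro a b hab j
    rcases j with ⟨z, D, h, C⟩ | C
    · cases hab
      · exact ⟨envPort_ne_inr h C _, envPort_ne_inl h C _⟩
      · exact ⟨envPort_ne_inl h C _, envPort_ne_inr h C _⟩
    · cases hab <;> simp [appPort]
  total := by
    rintro ((⟨z, D, h, C⟩ | C) | (⟨z, D, h, C⟩ | C))
    · exact .inl ⟨.hyp z D (lookup_union_of_left h) C, envPort_left (lookup_union_of_left h) h C⟩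
    · cases C with
      | lolliL C =>
        cases hC : C.sign
        · exact .inr (.inl ⟨_, .neg C hC⟩)
        · exact .inr (.inr ⟨_, .pos C hC⟩)
      | lolliR C => exact .inl ⟨.goal C, rfl⟩
    · exact .inl ⟨.hyp z D (lookup_union_of_right hΓΔ h) C,
        envPort_right hΓΔ (lookup_union_of_right hΓΔ h) h C⟩
    · cases hC : C.sign
      · exact .inr (.inr ⟨_, .neg C hC⟩)
      · exact .inr (.inl ⟨_, .pos C hC⟩)

theorem appMove_iff {P₁ P₂ : Type} (hΓΔ : Γ.Disjoint Δ) (r₁ : JOcc Γ (.lolli A B) → P₁)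
    (r₂ : JOcc Δ A → P₂) (m₁ : P₁ → P₁ → Prop) (m₂ : P₂ → P₂ → Prop)
    (o o' : Occ₂ (JOcc (Γ ∪ Δ) B) P₁ P₂) :
    AppMove r₁ r₂ m₁ m₂ o o' ↔ (∃ p p', Sum.LiftRel m₁ m₂ p p' ∧ Occ₂.equiv _ _ _ (.inr p) = o ∧
      Occ₂.equiv _ _ _ (.inr p') = o') ∨
      Link (Occ₂.equiv _ _ _) JOcc.entry (Sum.map r₁ r₂) appPort (AppCut Γ Δ A B) o o' := by
  constructor
  · intro h
    cases h with
    | left o o' h => exact .inl ⟨_, _, .inl h, rfl, rfl⟩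
    | right o o' h => exact .inl ⟨_, _, .inr h, rfl, rfl⟩
    | arg_pos C hC => exact .inr (.of_cut _ _ (.pos C hC) rfl rfl)
    | arg_neg C hC => exact .inr (.of_cut _ _ (.neg C hC) rfl rfl)
    | res_pos C hC =>
      exact .inr (.of_down (.goal C) (by simpa [JOcc.entry, Hole.sign, Hole.Pos, Hole.Neg] using hC) rfl rfl)
    | res_neg C hC =>
      exact .inr (.of_up (.goal C) (by simpa [JOcc.entry, Hole.sign, Hole.Pos, Hole.Neg] using hC) rfl rfl)
    | envL_pos z D h h' C hC =>
      exact .inr (.of_up (.hyp z D h C) hC rfl (by rw [appPort, envPort_left h h']; rfl))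
    | envL_neg z D h h' C hC =>
      exact .inr (.of_down (.hyp z D h C) hC (by rw [appPort, envPort_left h h']; rfl) rfl)
    | envR_pos z D h h' C hC =>
      exact .inr (.of_up (.hyp z D h C) hC rfl (by rw [appPort, envPort_right hΓΔ h h']; rfl))
    | envR_neg z D h h' C hC =>
      exact .inr (.of_down (.hyp z D h C) hC (by rw [appPort, envPort_right hΓΔ h h']; rfl) rfl)
  · rintro (⟨p, p', h, rfl, rfl⟩ | h)
    · cases h with
      | inl h => exact .left _ _ h
      | inr h => exact .right _ _ h
    · cases h with
      | up j h =>
        rcases j with (⟨z, D, h', C⟩ | C) <;> simp [JOcc.entry] at h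
        · by_cases hz : z ∈ Γ
          · rw [appPort, envPort_left h' (lookup_union_left' hz h')]
            exact .envL_pos _ _ _ _ _ h
          · rw [appPort, envPort_right hΓΔ h' (lookup_union_right' hz h')]
            exact .envR_pos _ _ _ _ _ h
        · exact .res_neg _ h
      | down j h =>
        rcases j with (⟨z, D, h', C⟩ | C) <;> simp [JOcc.entry] at h
        · by_cases hz : z ∈ Γ
          · rw [appPort, envPort_left h' (lookup_union_left' hz h')]
            exact .envL_neg _ _ _ _ _ h
          · rw [appPort, envPort_right hΓΔ h' (lookup_union_right' hz h')]
            exact .envR_neg _ _ _ _ _ h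
        · exact .res_pos _ h
      | cut a b h =>
        cases h with
        | pos C hC => exact .arg_pos C hC
        | neg C hC => exact .arg_neg C hC

end Rules

/-! ### Acyclicity of derivations -/

section Acyclic

variable {𝒰 : Signature} {Γ Δ : Env} {M N : Term 𝒰} {A B E : Ty}

theorem root_injective : ∀ {Γ : Env} {M : Term 𝒰} {A : Ty} (π : Deriv 𝒰 Γ M A),
    (root π).Injective
  | _, _, _, .var _ _ => fun _ _ h => h
  | _, _, _, .bit _ _ => fun _ _ h => h
  | _, _, _, .unitary _ => fun _ _ h => h
  | _, _, _, .lam _ _ _ _ => fun _ _ h => Occ₁.root.inj h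
  | _, _, _, .lamPair _ _ _ _ _ _ _ _ => fun _ _ h => Occ₁.root.inj h
  | _, _, _, .app _ _ _ => fun _ _ h => Occ₂.root.inj h
  | _, _, _, .tens _ _ _ => fun _ _ h => Occ₂.root.inj h

/-- The dependencies between the occurrences of a derivation: the moves, and the edges from the
arguments to the results of the unitary axioms. -/
inductive Edge (π : Deriv 𝒰 Γ M A) : Occ π → Occ π → Prop
  | move {o o' : Occ π} (h : Move π o o') : Edge π o o'
  | gate (g : Gate 𝒰 (Occ π)) (hg : g ∈ gates π) (k k' : Fin (𝒰.arity g.sym)) :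
      Edge π (g.arg k) (g.res k')

/-- The dependencies once the variables have been given values. -/
inductive Closed (γ : ∀ (_ : ℕ) (B : Ty), Hole B → Hole B → Prop) (π : Deriv 𝒰 Γ M A) :
    Occ π → Occ π → Prop
  | edge {o o' : Occ π} (h : Edge π o o') : Closed γ π o o'
  | env (x : ℕ) (B : Ty) (h : Γ.lookup x = some B) (C C' : Hole B) (hC : γ x B C C') :
      Closed γ π (root π (.hyp x B h C)) (root π (.hyp x B h C'))

/-- The dependencies in a derivation between the occurrences in the type of its term. -/
def Reach (γ : ∀ (_ : ℕ) (B : Ty), Hole B → Hole B → Prop) (π : Deriv 𝒰 Γ M A)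
    (C C' : Hole A) : Prop :=
  TransGen (Closed γ π) (root π (.goal C)) (root π (.goal C'))

/-- An assignment of values to variables, changed at `x`. -/
inductive Ext (γ : ∀ (_ : ℕ) (B : Ty), Hole B → Hole B → Prop) (x : ℕ) (A : Ty)
    (S : Hole A → Hole A → Prop) : ∀ (_ : ℕ) (B : Ty), Hole B → Hole B → Prop
  | self {C C' : Hole A} (h : S C C') : Ext γ x A S x A C C'
  | other {z : ℕ} {D : Ty} {C C' : Hole D} (hz : z ≠ x) (h : γ z D C C') : Ext γ x A S z D C C'

theorem Ext.val {γ : ∀ (_ : ℕ) (B : Ty), Hole B → Hole B → Prop} {x : ℕ}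
    {S : Hole A → Hole A → Prop} (hγ : ∀ z D, Γ.lookup z = some D → Val D (γ z D)) (hS : Val A S) :
    ∀ z D, (Γ.insert x A).lookup z = some D → Val D (Ext γ x A S z D) := by
  intro z D h
  by_cases hz : z = x
  · subst hz
    obtain rfl : A = D := by simpa using h
    refine hS.mono fun C C' h => ?_
    cases h with
    | self h => exact h
    | other hz => exact absurd rfl hz
  · rw [Finmap.lookup_insert_of_ne _ hz] at h
    refine (hγ z D h).mono fun C C' h => ?_
    cases h with
    | self h => exact absurd rfl hz
    | other _ h => exact h

theorem ne_of_lookup {x z : ℕ} {D : Ty} (hx : x ∉ Γ) (h : Γ.lookup z = some D) : z ≠ x := by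
  rintro rfl
  exact hx (Finmap.mem_of_lookup_eq_some h)

/-- `Link.collapse` for rules without a cut. -/
theorem Link.collapse' {J P JP O : Type} {e : J ⊕ P ≃ O} {ent : J → Bool} {r : JP → P} {φ : J → JP}
    (hr : r.Injective) (hφ : φ.Injective) {R : O → O → Prop} {EP : P → P → Prop}
    (hR : ∀ o o', R o o' → (∃ p p', EP p p' ∧ e (.inr p) = o ∧ e (.inr p') = o') ∨
      Link e ent r φ (fun _ _ => False) o o' ∨
      ∃ j j', EP (r (φ j)) (r (φ j')) ∧ e (.inl j) = o ∧ e (.inl j') = o')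
    (hP : WellFounded EP) :
    WellFounded R ∧ ∀ j j', TransGen R (e (.inl j)) (e (.inl j')) →
      TransGen EP (r (φ j)) (r (φ j')) := by
  have := Link.collapse hr hφ hR (by simpa using hP)
  simpa using this

variable {γ : ∀ (_ : ℕ) (B : Ty), Hole B → Hole B → Prop}

/-- The value `S` for the bound variable is arbitrary, since an environment edge of the conclusion
concerns some `z ≠ x`, for which `Ext` leaves the assignment unchanged. Such an edge is the copy,
through the port map, of one in the premise. -/
theorem closed_lam {x : ℕ} (hx : x ∉ Γ) (π : Deriv 𝒰 (Γ.insert x A) M B)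
    {S : Hole A → Hole A → Prop} (o o' : Occ (.lam x A hx π))
    (h : Closed γ (.lam x A hx π) o o') :
    (∃ p p', Closed (Ext γ x A S) π p p' ∧ Occ₁.equiv _ _ (.inr p) = o ∧
      Occ₁.equiv _ _ (.inr p') = o') ∨
    Link (Occ₁.equiv _ _) JOcc.entry (root π) (lamPort hx) (fun _ _ => False) o o' ∨
    ∃ j j', Closed (Ext γ x A S) π (root π (lamPort hx j)) (root π (lamPort hx j')) ∧
      Occ₁.equiv _ _ (.inl j) = o ∧ Occ₁.equiv _ _ (.inl j') = o' := by
  rcases h with h | ⟨z, D, hz, C, C', hC⟩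
  · rcases h with h | ⟨g, hg, k, k'⟩
    · rcases (lamMove_iff hx _ _ _ _).1 h with ⟨p, p', hp, rfl, rfl⟩ | h
      · exact .inl ⟨p, p', .edge (.move hp), rfl, rfl⟩
      · exact .inr (.inl h)
    · obtain ⟨g, hg', rfl⟩ := List.mem_map.1 hg
      exact .inl ⟨_, _, .edge (.gate g hg' k k'), rfl, rfl⟩
  · exact .inr (.inr ⟨.hyp z D hz C, .hyp z D hz C',
      .env _ _ _ _ _ (.other (ne_of_lookup hx hz) hC), rfl, rfl⟩)

theorem closed_lamPair {x y : ℕ} (hx : x ∉ Γ) (hy : y ∉ Γ) (hxy : x ≠ y)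
    (π : Deriv 𝒰 ((Γ.insert x A : Env).insert y B : Env) M E) {S : Hole A → Hole A → Prop}
    {S' : Hole B → Hole B → Prop}
    (o o' : Occ (Deriv.lamPair x y A B hx hy hxy π))
    (h : Closed γ (Deriv.lamPair x y A B hx hy hxy π) o o') :
    (∃ p p', Closed (Ext (Ext γ x A S) y B S') π p p' ∧ Occ₁.equiv _ _ (.inr p) = o ∧
      Occ₁.equiv _ _ (.inr p') = o') ∨
    Link (Occ₁.equiv _ _) JOcc.entry (root π) (lamPairPort hx hy hxy) (fun _ _ => False) o o' ∨
    ∃ j j', Closed (Ext (Ext γ x A S) y B S') π (root π (lamPairPort hx hy hxy j))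
      (root π (lamPairPort hx hy hxy j')) ∧
      Occ₁.equiv _ _ (.inl j) = o ∧ Occ₁.equiv _ _ (.inl j') = o' := by
  rcases h with h | ⟨z, D, hz, C, C', hC⟩
  · rcases h with h | ⟨g, hg, k, k'⟩
    · rcases (lamPairMove_iff hx hy hxy _ _ _ _).1 h with ⟨p, p', hp, rfl, rfl⟩ | h
      · exact .inl ⟨p, p', .edge (.move hp), rfl, rfl⟩
      · exact .inr (.inl h)
    · obtain ⟨g, hg', rfl⟩ := List.mem_map.1 hg
      exact .inl ⟨_, _, .edge (.gate g hg' k k'), rfl, rfl⟩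
  · exact .inr (.inr ⟨.hyp z D hz C, .hyp z D hz C', .env _ _ _ _ _
      (.other (ne_of_lookup hy hz) (.other (ne_of_lookup hx hz) hC)), rfl, rfl⟩)

theorem closed_envPort (π : Deriv 𝒰 Γ M A) (ρ : Deriv 𝒰 Δ N B) {z : ℕ} {D : Ty}
    (hz : (Γ ∪ Δ).lookup z = some D) {C C' : Hole D} (hC : γ z D C C') :
    Sum.LiftRel (Closed γ π) (Closed γ ρ) (Sum.map (root π) (root ρ) (envPort A B z D hz C))
      (Sum.map (root π) (root ρ) (envPort A B z D hz C')) := by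
  unfold envPort
  split_ifs
  · exact .inl (.env _ _ _ _ _ hC)
  · exact .inr (.env _ _ _ _ _ hC)

theorem closed_tens (hΓΔ : Γ.Disjoint Δ) (π : Deriv 𝒰 Γ M A) (ρ : Deriv 𝒰 Δ N B)
    (o o' : Occ (.tens hΓΔ π ρ)) (h : Closed γ (.tens hΓΔ π ρ) o o') :
    (∃ p p', Sum.LiftRel (Closed γ π) (Closed γ ρ) p p' ∧ Occ₂.equiv _ _ _ (.inr p) = o ∧
      Occ₂.equiv _ _ _ (.inr p') = o') ∨
    Link (Occ₂.equiv _ _ _) JOcc.entry (Sum.map (root π) (root ρ)) tensPort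
      (fun _ _ => False) o o' ∨
    ∃ j j', Sum.LiftRel (Closed γ π) (Closed γ ρ) (Sum.map (root π) (root ρ) (tensPort j))
      (Sum.map (root π) (root ρ) (tensPort j')) ∧
      Occ₂.equiv _ _ _ (.inl j) = o ∧ Occ₂.equiv _ _ _ (.inl j') = o' := by
  rcases h with h | ⟨z, D, hz, C, C', hC⟩
  · rcases h with h | ⟨g, hg, k, k'⟩
    · rcases (tensMove_iff hΓΔ _ _ _ _ _ _).1 h with ⟨p, p', hp, rfl, rfl⟩ | h
      · exact .inl ⟨p, p', hp.mono (fun _ _ h => .edge (.move h)) (fun _ _ h => .edge (.move h)),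
          rfl, rfl⟩
      · exact .inr (.inl h)
    · rcases List.mem_append.1 hg with hg | hg <;> obtain ⟨g, hg', rfl⟩ := List.mem_map.1 hg
      · exact .inl ⟨_, _, .inl (.edge (.gate g hg' k k')), rfl, rfl⟩
      · exact .inl ⟨_, _, .inr (.edge (.gate g hg' k k')), rfl, rfl⟩
  · exact .inr (.inr ⟨.hyp z D hz C, .hyp z D hz C', closed_envPort π ρ hz hC, rfl, rfl⟩)

theorem closed_app (hΓΔ : Γ.Disjoint Δ) (π : Deriv 𝒰 Γ M (.lolli A B)) (ρ : Deriv 𝒰 Δ N A)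
    (o o' : Occ (.app hΓΔ π ρ)) (h : Closed γ (.app hΓΔ π ρ) o o') :
    (∃ p p', Sum.LiftRel (Closed γ π) (Closed γ ρ) p p' ∧ Occ₂.equiv _ _ _ (.inr p) = o ∧
      Occ₂.equiv _ _ _ (.inr p') = o') ∨
    Link (Occ₂.equiv _ _ _) JOcc.entry (Sum.map (root π) (root ρ)) appPort
      (AppCut Γ Δ A B) o o' ∨
    ∃ j j', Sum.LiftRel (Closed γ π) (Closed γ ρ) (Sum.map (root π) (root ρ) (appPort j))
      (Sum.map (root π) (root ρ) (appPort j')) ∧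
      Occ₂.equiv _ _ _ (.inl j) = o ∧ Occ₂.equiv _ _ _ (.inl j') = o' := by
  rcases h with h | ⟨z, D, hz, C, C', hC⟩
  · rcases h with h | ⟨g, hg, k, k'⟩
    · rcases (appMove_iff hΓΔ _ _ _ _ _ _).1 h with ⟨p, p', hp, rfl, rfl⟩ | h
      · exact .inl ⟨p, p', hp.mono (fun _ _ h => .edge (.move h)) (fun _ _ h => .edge (.move h)),
          rfl, rfl⟩
      · exact .inr (.inl h)
    · rcases List.mem_append.1 hg with hg | hg <;> obtain ⟨g, hg', rfl⟩ := List.mem_map.1 hg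
      · exact .inl ⟨_, _, .inl (.edge (.gate g hg' k k')), rfl, rfl⟩
      · exact .inl ⟨_, _, .inr (.edge (.gate g hg' k k')), rfl, rfl⟩
  · exact .inr (.inr ⟨.hyp z D hz C, .hyp z D hz C', closed_envPort π ρ hz hC, rfl, rfl⟩)

theorem lookup_singleton {x z : ℕ} {D : Ty}
    (h : (Finmap.singleton x A : Env).lookup z = some D) : x = z ∧ A = D := by
  by_cases hz : z = x
  · subst hz
    exact ⟨rfl, by simpa using h⟩
  · have := Finmap.mem_of_lookup_eq_some h
    simp [hz] at this

/-- Identify the two copies of `A`. The crossing moves become stutters from level 0 to level 1, and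
what remains is the value assigned to `x`. -/
theorem sound_var (x : ℕ) (A : Ty) (hγ : Val A (γ x A)) :
    WellFounded (Closed γ (Deriv.var (𝒰 := 𝒰) x A)) ∧ Val A (Reach γ (Deriv.var (𝒰 := 𝒰) x A)) := by
  let c : JOcc (Finmap.singleton x A) A → Hole A
    | .hyp z D h C => (lookup_singleton h).2 ▸ C
    | .goal C => C
  let lev : JOcc (Finmap.singleton x A) A → ℕ
    | .hyp z D h C => if C.sign then 0 else 1
    | .goal C => if C.sign then 1 else 0
  have key : ∀ a a', Closed γ (Deriv.var (𝒰 := 𝒰) x A) a a' →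
      γ x A (c a) (c a') ∨ (c a = c a' ∧ lev a < lev a') := by
    intro a a' h
    rcases h with h | ⟨z, D, hz, C, C', hC⟩
    · rcases h with h | ⟨g, hg, _, _⟩
      · rcases h with ⟨C, h, hC⟩ | ⟨C, h, hC⟩
        · exact .inr ⟨rfl, by simp only [Hole.Pos] at hC; simp [lev, hC]⟩
        · exact .inr ⟨rfl, by simp only [Hole.Neg] at hC; simp [lev, hC]⟩
      · simp [gates] at hg
    · obtain ⟨rfl, rfl⟩ := lookup_singleton hz
      exact .inl hC
  refine ⟨wellFounded_of_collapse c lev hγ.wellFounded key, hγ.transGen.mono fun C C' h => ?_⟩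
  rcases transGen_of_collapse c lev key h with h | ⟨h, hl⟩
  · exact h
  · have h : C = C' := h
    rw [h] at hl
    exact absurd hl (lt_irrefl _)

/-- Arguments and results of unitary axioms carry only bits, and bits joined by tensors cannot
depend on each other. -/
theorem Val.pow : ∀ n {R : Hole (Ty.pow n) → Hole (Ty.pow n) → Prop}, Val (Ty.pow n) R →
    ∀ C C', ¬ R C C'
  | 0, _, h => h
  | 1, _, h => h
  | n + 2, R, h => by
    obtain ⟨h1, h2, h3, h4⟩ := h
    intro C C'
    cases C <;> cases C'
    · exact h3 _ _
    · exact h1 _ _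
    · exact h2 _ _
    · exact Val.pow (n + 1) h4 _ _

/-- All edges lead from the argument side to the result side. No argument value can lead back, by
`Val.pow`, so no two edges compose and no dependency arises among the results. -/
theorem sound_unitary (U : 𝒰.Sym) : WellFounded (Closed γ (Deriv.unitary U)) ∧
    Val _ (Reach γ (Deriv.unitary U)) := by
  have key : ∀ o o', Closed γ (Deriv.unitary U) o o' →
      ∃ C C', o = root (.unitary U) (.goal (.lolliL C)) ∧
        o' = root (.unitary U) (.goal (.lolliR C')) := by
    intro o o' h
    rcases h with h | ⟨z, D, hz, C, C', hC⟩
    · rcases h with h | ⟨g, hg, k, k'⟩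
      · exact h.elim
      · simp only [gates, List.mem_singleton] at hg
        subst hg
        exact ⟨_, _, rfl, rfl⟩
    · simp at hz
  have hreach : ∀ C C', Reach γ (Deriv.unitary U) C C' →
      ∃ D D', C = .lolliL D ∧ C' = .lolliR D' := by
    intro C C' h
    obtain ⟨_, h1, -⟩ := TransGen.head'_iff.1 h
    obtain ⟨_, -, h2⟩ := TransGen.tail'_iff.1 h
    obtain ⟨D, _, h1, -⟩ := key _ _ h1
    obtain ⟨_, D', -, h2⟩ := key _ _ h2
    exact ⟨D, D', JOcc.goal.inj (root_injective _ h1), JOcc.goal.inj (root_injective _ h2)⟩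
  let lev : Hole (.lolli (Ty.pow (𝒰.arity U)) (Ty.pow (𝒰.arity U))) → ℕ
    | .lolliL _ => 0
    | .lolliR _ => 1
  let lev' : Occ (Deriv.unitary U) → ℕ
    | .hyp _ _ _ _ => 0
    | .goal C => lev C
  refine ⟨Subrelation.wf (r := InvImage (· < ·) lev') ?_ (InvImage.wf lev' Nat.lt_wfRel.wf),
    fun S hS => ?_⟩
  · intro o o' h
    obtain ⟨C, C', rfl, rfl⟩ := key _ _ h
    exact Nat.zero_lt_one
  have hT : ∀ C C', (Reach γ (Deriv.unitary U) C C' ∨ ArgRel S C C') →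
      ∃ D D', C = .lolliL D ∧ C' = .lolliR D' := by
    rintro C C' (h | h)
    · exact hreach _ _ h
    · cases h with
      | mk h => exact absurd h (Val.pow _ hS _ _)
  refine ⟨Subrelation.wf (r := InvImage (· < ·) lev) ?_ (InvImage.wf lev Nat.lt_wfRel.wf),
    (Val.empty _).mono fun C C' h => ?_⟩
  · intro o o' h
    obtain ⟨C, C', rfl, rfl⟩ := hT _ _ h
    exact Nat.zero_lt_one
  · obtain ⟨_, h, -⟩ := TransGen.head'_iff.1 h
    obtain ⟨_, _, h, -⟩ := hT _ _ h
    cases h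

theorem sound_bit (b : Bool) (n : ℕ) : WellFounded (Closed γ (Deriv.bit (𝒰 := 𝒰) b n)) ∧
    Val _ (Reach γ (Deriv.bit (𝒰 := 𝒰) b n)) := by
  have key : ∀ o o', ¬ Closed γ (Deriv.bit (𝒰 := 𝒰) b n) o o' := by
    rintro o o' (h | ⟨z, D, hz, C, C', hC⟩)
    · rcases h with h | ⟨g, hg, k, k'⟩
      · exact h
      · simp [gates] at hg
    · simp at hz
  refine ⟨⟨fun o => ⟨_, fun o' h => absurd h (key _ _)⟩⟩, fun C C' h => ?_⟩
  obtain ⟨_, h, -⟩ := TransGen.head'_iff.1 h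
  exact key _ _ h

/-- Connecting a value `S` to the argument of `λx.M` amounts to assigning `S` to `x` in the premise:
after contraction, every path of the first graph is one of the second. For mere acyclicity, `S` is
taken empty. -/
theorem sound_lam {x : ℕ} (hx : x ∉ Γ) (π : Deriv 𝒰 (Γ.insert x A) M B)
    (ih : ∀ S, Val A S → WellFounded (Closed (Ext γ x A S) π) ∧ Val B (Reach (Ext γ x A S) π)) :
    WellFounded (Closed γ (.lam x A hx π)) ∧ Val _ (Reach γ (.lam x A hx π)) := by
  have key S (hS : Val A S) := Link.collapse' (root_injective π) (lamPort_wiring hx).inj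
    (closed_lam hx π (γ := γ) (S := S)) (ih S hS).1
  refine ⟨(key _ (Val.empty A)).1, fun S hS => ?_⟩
  let f : Hole (.lolli A B) → Occ π := fun C => root π (lamPort hx (.goal C))
  have hT : ∀ C C', (Reach γ (.lam x A hx π) C C' ∨ ArgRel S C C') →
      TransGen (Closed (Ext γ x A S) π) (f C) (f C') := by
    rintro C C' (h | h)
    · exact (key S hS).2 _ _ h
    · cases h with
      | mk h => exact .single (.env _ _ _ _ _ (.self h))
  exact ⟨Subrelation.wf (fun h => hT _ _ h) (InvImage.wf f (ih S hS).1.transGen),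
    (ih S hS).2.mono fun C C' h => TransGen.lift' f hT _ _ h⟩

/-- As for `sound_lam`; a value of `A ⊗ B` splits into values for `x` and `y`, and the absence of
cross dependencies ensures that no edge of it is lost. -/
theorem sound_lamPair {x y : ℕ} (hx : x ∉ Γ) (hy : y ∉ Γ) (hxy : x ≠ y)
    (π : Deriv 𝒰 ((Γ.insert x A : Env).insert y B : Env) M E)
    (ih : ∀ S S', Val A S → Val B S' → WellFounded (Closed (Ext (Ext γ x A S) y B S') π) ∧
      Val E (Reach (Ext (Ext γ x A S) y B S') π)) :
    WellFounded (Closed γ (.lamPair x y A B hx hy hxy π)) ∧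
      Val _ (Reach γ (.lamPair x y A B hx hy hxy π)) := by
  have key S S' (hS : Val A S) (hS' : Val B S') :=
    Link.collapse' (root_injective π) (lamPairPort_wiring hx hy hxy).inj
    (closed_lamPair hx hy hxy π (γ := γ) (S := S) (S' := S')) (ih S S' hS hS').1
  refine ⟨(key _ _ (Val.empty A) (Val.empty B)).1, fun S ⟨hn, hn', hS, hS'⟩ => ?_⟩
  let f : Hole (.lolli (.tens A B) E) → Occ π := fun C => root π (lamPairPort hx hy hxy (.goal C))
  have hT : ∀ C C', (Reach γ (.lamPair x y A B hx hy hxy π) C C' ∨ ArgRel S C C') →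
      TransGen (Closed (Ext (Ext γ x A fun C C' => S (.tensL C) (.tensL C')) y B
        fun C C' => S (.tensR C) (.tensR C')) π) (f C) (f C') := by
    rintro C C' (h | h)
    · exact (key _ _ hS hS').2 _ _ h
    · cases h with
      | @mk C C' h =>
        cases C <;> cases C'
        · exact .single (.env _ _ _ _ _ (.other hxy (.self h)))
        · exact absurd h (hn _ _)
        · exact absurd h (hn' _ _)
        · exact .single (.env _ _ _ _ _ (.self h))
  exact ⟨Subrelation.wf (fun h => hT _ _ h) (InvImage.wf f (ih _ _ hS hS').1.transGen),
    (ih _ _ hS hS').2.mono fun C C' h => TransGen.lift' f hT _ _ h⟩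

/-- After contraction the graph is the disjoint union of those of the premises, so no path joins the
two components. -/
theorem sound_tens (hΓΔ : Γ.Disjoint Δ) (π : Deriv 𝒰 Γ M A) (ρ : Deriv 𝒰 Δ N B)
    (hπ : WellFounded (Closed γ π) ∧ Val A (Reach γ π))
    (hρ : WellFounded (Closed γ ρ) ∧ Val B (Reach γ ρ)) :
    WellFounded (Closed γ (.tens hΓΔ π ρ)) ∧ Val _ (Reach γ (.tens hΓΔ π ρ)) := by
  obtain ⟨hw, hr⟩ := Link.collapse' ((root_injective π).sumMap (root_injective ρ))
    (tensPort_wiring hΓΔ).inj (closed_tens hΓΔ π ρ (γ := γ)) (wellFounded_liftRel hπ.1 hρ.1)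
  refine ⟨hw, fun C C' h => ?_, fun C C' h => ?_, hπ.2.mono fun C C' h => ?_,
    hρ.2.mono fun C C' h => ?_⟩
  · obtain ⟨_, h, -⟩ := transGen_liftRel_inl (hr (.goal (.tensL C)) (.goal (.tensR C')) h)
    cases h
  · obtain ⟨_, h, -⟩ := transGen_liftRel_inr (hr (.goal (.tensR C)) (.goal (.tensL C')) h)
    cases h
  · obtain ⟨_, h, h'⟩ := transGen_liftRel_inl (hr (.goal (.tensL C)) (.goal (.tensL C')) h)
    cases h
    exact h'
  · obtain ⟨_, h, h'⟩ := transGen_liftRel_inr (hr (.goal (.tensR C)) (.goal (.tensR C')) h)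
    cases h
    exact h'

/-- This is what `Val` at `A ⊸ B` is designed for. The function, as a value, connected to the value
`Reach γ ρ` of the argument, gives a well-founded graph `T` on the occurrences of `A ⊸ B`. A path in
the application alternates between paths inside the premises and cut edges, so it is controlled by
its trace on the ports of the cut, and this trace collapses onto `T`. -/
theorem sound_app (hΓΔ : Γ.Disjoint Δ) (π : Deriv 𝒰 Γ M (.lolli A B)) (ρ : Deriv 𝒰 Δ N A)
    (hπ : WellFounded (Closed γ π) ∧ Val _ (Reach γ π))
    (hρ : WellFounded (Closed γ ρ) ∧ Val A (Reach γ ρ)) :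
    WellFounded (Closed γ (.app hΓΔ π ρ)) ∧ Val _ (Reach γ (.app hΓΔ π ρ)) := by
  obtain ⟨hTw, hTv⟩ := hπ.2 _ hρ.2
  set T : Hole (.lolli A B) → Hole (.lolli A B) → Prop :=
    fun C C' => Reach γ π C C' ∨ ArgRel (Reach γ ρ) C C' with hTdef
  let G := Sum.LiftRel (Closed γ π) (Closed γ ρ)
  let p : Hole (.lolli A B) ⊕ Hole A → Occ π ⊕ Occ ρ :=
    Sum.map (fun C => root π (.goal C)) (fun C => root ρ (.goal C))
  have hp : p.Injective := Function.Injective.sumMap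
    (fun C C' h => JOcc.goal.inj (root_injective π h))
    (fun C C' h => JOcc.goal.inj (root_injective ρ h))
  let K' : Hole (.lolli A B) ⊕ Hole A → Hole (.lolli A B) ⊕ Hole A → Prop :=
    fun i j => AppCut Γ Δ A B (Sum.map .goal .goal i) (Sum.map .goal .goal j)
  have hK : ∀ a b, (∃ c d, a = Sum.map (root π) (root ρ) c ∧ b = Sum.map (root π) (root ρ) d ∧
      AppCut Γ Δ A B c d) → ∃ i j, a = p i ∧ b = p j ∧ K' i j := by
    rintro _ _ ⟨c, d, rfl, rfl, hcd⟩
    cases hcd with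
    | pos C hC => exact ⟨.inr C, .inl (.lolliL C), rfl, rfl, .pos C hC⟩
    | neg C hC => exact ⟨.inl (.lolliL C), .inr C, rfl, rfl, .neg C hC⟩
  -- Identifies the two copies of `A`, so that cut edges become stutters. Each starts at a hole that
  -- is positive in its own type and ends at a negative one, whence the levels 0 and 1.
  let c : Hole (.lolli A B) ⊕ Hole A → Hole (.lolli A B) := Sum.elim id .lolliL
  let lev : Hole (.lolli A B) ⊕ Hole A → ℕ
    | .inl C => if C.sign then 0 else 1
    | .inr C => if C.sign then 0 else 1
  have hW : ∀ i j, (TransGen G (p i) (p j) ∨ K' i j) →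
      T (c i) (c j) ∨ (c i = c j ∧ lev i < lev j) := by
    rintro i j (h | h)
    · rcases i with C | C
      · obtain ⟨o, ho, h⟩ := transGen_liftRel_inl h
        rcases j with C' | C'
        · cases ho
          exact .inl (.inl h)
        · cases ho
      · obtain ⟨o, ho, h⟩ := transGen_liftRel_inr h
        rcases j with C' | C'
        · cases ho
        · cases ho
          exact .inl (.inr ⟨h⟩)
    · refine .inr ?_
      change AppCut Γ Δ A B (Sum.map .goal .goal i) (Sum.map .goal .goal j) at h
      generalize hi : (Sum.map .goal .goal i : JOcc Γ (.lolli A B) ⊕ JOcc Δ A) = i',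
        hj : (Sum.map .goal .goal j : JOcc Γ (.lolli A B) ⊕ JOcc Δ A) = j' at h
      cases h with
      | pos C hC =>
        rcases i with i | i <;> rcases j with j | j <;>
          simp only [Sum.map_inl, Sum.map_inr, reduceCtorEq, Sum.inl.injEq, Sum.inr.injEq,
            JOcc.goal.injEq] at hi hj
        subst hi hj
        simp only [Hole.Pos] at hC
        simp [c, lev, Hole.sign, hC]
      | neg C hC =>
        rcases i with i | i <;> rcases j with j | j <;>
          simp only [Sum.map_inl, Sum.map_inr, reduceCtorEq, Sum.inl.injEq, Sum.inr.injEq,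
            JOcc.goal.injEq] at hi hj
        subst hi hj
        simp only [Hole.Neg] at hC
        simp [c, lev, Hole.sign, hC]
  obtain ⟨hw, hr⟩ := Link.collapse ((root_injective π).sumMap (root_injective ρ))
    (appPort_wiring hΓΔ).inj (closed_app hΓΔ π ρ (γ := γ))
    (wellFounded_of_ports hp (wellFounded_liftRel hπ.1 hρ.1) hK
      (wellFounded_of_collapse c lev hTw hW))
  refine ⟨hw, hTv.mono fun C C' h => ?_⟩
  -- Acyclicity, just obtained, excludes a path from a port to itself; `transGen_of_ports` needs
  -- distinct ends.
  have hne : C ≠ C' := by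
    rintro rfl
    exact not_transGen_self hw _ h
  have := transGen_of_ports hp hK (i := .inl (.lolliR C)) (j := .inl (.lolliR C'))
    (hr (.goal C) (.goal C') h) (by simpa using hne)
  rcases transGen_of_collapse c lev hW this with h | ⟨h, -⟩
  · exact h
  · exact absurd (Hole.lolliR.inj h) hne

/-- The fundamental lemma: a derivation, closed by values, is acyclic and behaves as a value. -/
theorem sound : ∀ {Γ : Env} {M : Term 𝒰} {A : Ty} (π : Deriv 𝒰 Γ M A)
    (γ : ∀ (_ : ℕ) (B : Ty), Hole B → Hole B → Prop)
    (_ : ∀ z D, Γ.lookup z = some D → Val D (γ z D)),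
    WellFounded (Closed γ π) ∧ Val A (Reach γ π)
  | _, _, _, .var x A, _, hγ => sound_var x A (hγ x A Finmap.lookup_singleton_eq)
  | _, _, _, .bit b n, _, _ => sound_bit b n
  | _, _, _, .unitary U, _, _ => sound_unitary U
  | _, _, _, .lam _ _ hx π, _, hγ => sound_lam hx π fun _ hS => sound π _ (Ext.val hγ hS)
  | _, _, _, .lamPair _ _ _ _ hx hy hxy π, _, hγ => sound_lamPair hx hy hxy π fun _ _ hS hS' =>
      sound π _ (Ext.val (Ext.val hγ hS) hS')
  | _, _, _, .app hΓΔ π ρ, γ, hγ => sound_app hΓΔ π ρ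
      (sound π γ fun z D h => hγ z D (lookup_union_of_left h))
      (sound ρ γ fun z D h => hγ z D (lookup_union_of_right hΓΔ h))
  | _, _, _, .tens hΓΔ π ρ, γ, hγ => sound_tens hΓΔ π ρ
      (sound π γ fun z D h => hγ z D (lookup_union_of_left h))
      (sound ρ γ fun z D h => hγ z D (lookup_union_of_right hΓΔ h))

/-- Assign the empty value to every free variable. -/
theorem wellFounded_edge (π : Deriv 𝒰 Γ M A) : WellFounded (Edge π) :=
  Subrelation.wf (fun h => .edge h) (sound π (fun _ _ _ _ => False) fun _ _ _ => Val.empty _).1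

end Acyclic

/-! ### The local structure of derivations -/

/-- `H I X` is a set of transitions from the occurrences in `I` to those in `X`, in a derivation
whose ports are embedded by `b`: each occurrence is the source of exactly one transition, unless
it is an exit. -/
structure Half {J O : Type} (b : J → O) (ent : J → Bool) (H : Set O → Set O → Prop) : Prop where
  uniq : ∀ {I X I' X' o}, H I X → H I' X' → o ∈ I → o ∈ I' → I = I' ∧ X = X'
  entry : ∀ {I X j}, H I X → b j ∈ I → ent j = true
  total : ∀ o, (∃ j, ent j = false ∧ b j = o) ∨ ∃ I X, H I X ∧ o ∈ I

/-! ### Gluing transitions along the wiring of a rule -/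

section Abstract

variable {J P JP O P₁ P₂ J₁ J₂ : Type} {e : J ⊕ P ≃ O} {ent : J → Bool} {entP : JP → Bool}
  {r : JP → P} {φ : J → JP} {κ : JP → JP → Prop}

theorem Link.swap_iff {o o' : O} : Link e (fun j => !ent j) r φ (Function.swap κ) o o' ↔
    Link e ent r φ κ o' o := by
  constructor
  · rintro (⟨j, h⟩ | ⟨j, h⟩ | ⟨a, b, h⟩)
    · exact .down j (by simpa using h)
    · exact .up j (by simpa using h)
    · exact .cut _ _ h
  · rintro (⟨j, h⟩ | ⟨j, h⟩ | ⟨a, b, h⟩)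
    · exact .down j (by simpa using h)
    · exact .up j (by simpa using h)
    · exact .cut _ _ h

theorem Link.unique (w : Wiring ent entP φ κ) (hr : r.Injective) {o o' a b : O} (hoo' : o = o')
    (h : Link e ent r φ κ o a) (h' : Link e ent r φ κ o' b) : a = b := by
  cases h <;> cases h' <;>
    simp only [EmbeddingLike.apply_eq_iff_eq, Sum.inl.injEq, Sum.inr.injEq, reduceCtorEq] at hoo'
  · rw [hoo']
  · rw [w.inj (hr hoo')]
  · rename_i h
    exact absurd (hr hoo') (w.ne h _).1
  · rename_i h _ _
    exact absurd (hr hoo').symm (w.ne h _).1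
  · rename_i h _ _ h'
    rw [hr hoo'] at h
    rw [w.right_unique h h']

/-- The transitions of the premises, and the links. -/
inductive LinkHyper (e : J ⊕ P ≃ O) (ent : J → Bool) (r : JP → P) (φ : J → JP)
    (κ : JP → JP → Prop) (H : Set P → Set P → Prop) : Set O → Set O → Prop
  | prem {I X : Set P} (h : H I X) :
      LinkHyper e ent r φ κ H ((fun p => e (.inr p)) '' I) ((fun p => e (.inr p)) '' X)
  | link {o o' : O} (h : Link e ent r φ κ o o') : LinkHyper e ent r φ κ H {o} {o'}

theorem LinkHyper.swap_iff {H : Set P → Set P → Prop} {I X : Set O} :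
    LinkHyper e (fun j => !ent j) r φ (Function.swap κ) (Function.swap H) I X ↔
      LinkHyper e ent r φ κ H X I := by
  constructor
  · rintro (⟨h⟩ | ⟨h⟩)
    · exact .prem h
    · exact .link (Link.swap_iff.1 h)
  · rintro (⟨h⟩ | ⟨h⟩)
    · exact .prem h
    · exact .link (Link.swap_iff.2 h)

/-- An exit of a premise, where no transition of the premise starts, acquires exactly one outgoing
link: down to the conclusion or across a cut. Entries of the conclusion acquire one upward. -/
theorem Half.link (w : Wiring ent entP φ κ) (hr : r.Injective) {H : Set P → Set P → Prop}
    (h : Half r entP H) : Half (fun j => e (.inl j)) ent (LinkHyper e ent r φ κ H) := by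
  -- Links leave premises only at exits, transitions of a premise never start there: the two kinds
  -- cannot compete for a token.
  have hfalse : ∀ {I X p a}, H I X → p ∈ I → Link e ent r φ κ (e (.inr p)) a → False := by
    intro I X p a hI hp hl
    generalize ho : e (.inr p) = o at hl
    cases hl with
    | up j hj => simp at ho
    | down j hj =>
      obtain rfl : p = r (φ j) := by simpa using ho
      have := h.entry hI hp
      rw [w.ent_eq, hj] at this
      cases this
    | cut a b hab =>
      obtain rfl : p = r a := by simpa using ho
      have := h.entry hI hp
      rw [w.left hab] at this
      cases this
  refine ⟨?_, ?_, ?_⟩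
  · intro I X I' X' o h1 h2 ho ho'
    cases h1 with
    | prem h1 =>
      obtain ⟨p, hp, rfl⟩ := ho
      cases h2 with
      | prem h2 =>
        obtain ⟨p', hp', heq⟩ := ho'
        obtain rfl : p' = p := by simpa using heq
        obtain ⟨rfl, rfl⟩ := h.uniq h1 h2 hp hp'
        exact ⟨rfl, rfl⟩
      | link h2 =>
        rw [Set.mem_singleton_iff] at ho'
        subst ho'
        exact (hfalse h1 hp h2).elim
    | link h1 =>
      rw [Set.mem_singleton_iff] at ho
      subst ho
      cases h2 with
      | prem h2 =>
        obtain ⟨p, hp, rfl⟩ := ho'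
        exact (hfalse h2 hp h1).elim
      | link h2 =>
        rw [Set.mem_singleton_iff] at ho'
        subst ho'
        exact ⟨rfl, by rw [Link.unique w hr rfl h1 h2]⟩
  · intro I X j h1 hj
    cases h1 with
    | prem h1 =>
      obtain ⟨p, -, hp⟩ := hj
      simp at hp
    | link h1 =>
      rw [Set.mem_singleton_iff] at hj
      cases h1 with
      | up j' h' =>
        obtain rfl : j = j' := by simpa using hj
        exact h'
      | down => simp at hj
      | cut => simp at hj
  · intro o
    obtain ⟨x, rfl⟩ := e.surjective o
    rcases x with j | p
    · cases hj : ent j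
      · exact .inl ⟨j, hj, rfl⟩
      · exact .inr ⟨_, _, .link (.up j hj), rfl⟩
    · rcases h.total p with ⟨a, ha, rfl⟩ | ⟨I, X, hI, hp⟩
      · rcases w.total a with ⟨j, rfl⟩ | ⟨b, hb⟩ | ⟨b, hb⟩
        · exact .inr ⟨_, _, .link (.down j (by rw [← w.ent_eq, ha])), rfl⟩
        · exact .inr ⟨_, _, .link (.cut _ _ hb), rfl⟩
        · rw [w.right hb] at ha
          cases ha
      · exact .inr ⟨_, _, .prem hI, p, hp, rfl⟩

/-- The transitions of two derivations side by side. -/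
inductive SumHyper (H₁ : Set P₁ → Set P₁ → Prop) (H₂ : Set P₂ → Set P₂ → Prop) :
    Set (P₁ ⊕ P₂) → Set (P₁ ⊕ P₂) → Prop
  | inl {I X : Set P₁} (h : H₁ I X) : SumHyper H₁ H₂ (Sum.inl '' I) (Sum.inl '' X)
  | inr {I X : Set P₂} (h : H₂ I X) : SumHyper H₁ H₂ (Sum.inr '' I) (Sum.inr '' X)

theorem SumHyper.swap_iff {H₁ : Set P₁ → Set P₁ → Prop} {H₂ : Set P₂ → Set P₂ → Prop}
    {I X : Set (P₁ ⊕ P₂)} :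
    SumHyper (Function.swap H₁) (Function.swap H₂) I X ↔ SumHyper H₁ H₂ X I := by
  constructor
  · rintro (⟨h⟩ | ⟨h⟩)
    · exact .inl h
    · exact .inr h
  · rintro (⟨h⟩ | ⟨h⟩)
    · exact .inl h
    · exact .inr h

theorem Half.sum {b₁ : J₁ → P₁} {b₂ : J₂ → P₂} {e₁ : J₁ → Bool} {e₂ : J₂ → Bool}
    {H₁ : Set P₁ → Set P₁ → Prop} {H₂ : Set P₂ → Set P₂ → Prop} (h₁ : Half b₁ e₁ H₁)
    (h₂ : Half b₂ e₂ H₂) : Half (Sum.map b₁ b₂) (Sum.elim e₁ e₂) (SumHyper H₁ H₂) where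
  uniq := by
    rintro _ _ _ _ _ (⟨h⟩ | ⟨h⟩) (⟨h'⟩ | ⟨h'⟩) ⟨o, ho, rfl⟩ ⟨o', ho', heq⟩
    · obtain rfl := Sum.inl.inj heq
      obtain ⟨rfl, rfl⟩ := h₁.uniq h h' ho ho'
      exact ⟨rfl, rfl⟩
    · cases heq
    · cases heq
    · obtain rfl := Sum.inr.inj heq
      obtain ⟨rfl, rfl⟩ := h₂.uniq h h' ho ho'
      exact ⟨rfl, rfl⟩
  entry := by
    rintro _ _ (j | j) (⟨h⟩ | ⟨h⟩) ⟨o, ho, heq⟩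
    · obtain rfl := Sum.inl.inj heq
      exact h₁.entry h ho
    · cases heq
    · cases heq
    · obtain rfl := Sum.inr.inj heq
      exact h₂.entry h ho
  total := by
    rintro (o | o)
    · rcases h₁.total o with ⟨j, hj, rfl⟩ | ⟨I, X, h, ho⟩
      · exact .inl ⟨.inl j, hj, rfl⟩
      · exact .inr ⟨_, _, .inl h, o, ho, rfl⟩
    · rcases h₂.total o with ⟨j, hj, rfl⟩ | ⟨I, X, h, ho⟩
      · exact .inl ⟨.inr j, hj, rfl⟩
      · exact .inr ⟨_, _, .inr h, o, ho, rfl⟩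

/-- `Half` in both directions. -/
def Full {J O : Type} (b : J → O) (ent : J → Bool) (H : Set O → Set O → Prop) : Prop :=
  Half b ent H ∧ Half b (fun j => !ent j) (Function.swap H)

theorem Half.congr {b : J → O} {H H' : Set O → Set O → Prop} (h : Half b ent H)
    (hH : ∀ I X, H' I X ↔ H I X) : Half b ent H' := by
  obtain rfl : H' = H := by
    funext I X
    exact propext (hH I X)
  exact h

theorem Full.congr {b : J → O} {H H' : Set O → Set O → Prop} (h : Full b ent H)
    (hH : ∀ I X, H' I X ↔ H I X) : Full b ent H' :=
  ⟨h.1.congr hH, h.2.congr fun I X => hH X I⟩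

theorem Full.link (w : Wiring ent entP φ κ) (hr : r.Injective) {H : Set P → Set P → Prop}
    (h : Full r entP H) : Full (fun j => e (.inl j)) ent (LinkHyper e ent r φ κ H) :=
  ⟨h.1.link w hr, (h.2.link w.swap hr).congr fun _ _ => LinkHyper.swap_iff.symm⟩

theorem Full.sum {b₁ : J₁ → P₁} {b₂ : J₂ → P₂} {e₁ : J₁ → Bool} {e₂ : J₂ → Bool}
    {H₁ : Set P₁ → Set P₁ → Prop} {H₂ : Set P₂ → Set P₂ → Prop} (h₁ : Full b₁ e₁ H₁)
    (h₂ : Full b₂ e₂ H₂) : Full (Sum.map b₁ b₂) (Sum.elim e₁ e₂) (SumHyper H₁ H₂) := by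
  refine ⟨h₁.1.sum h₂.1, ?_⟩
  have := (h₁.2.sum h₂.2).congr (H' := Function.swap (SumHyper H₁ H₂))
    fun _ _ => SumHyper.swap_iff.symm
  convert this using 1
  funext j
  cases j <;> rfl

end Abstract

/-! ### The transitions of a derivation -/

section Derivations

variable {𝒰 : Signature} {Γ Δ Θ : Env} {M N L : Term 𝒰} {A B E : Ty}

/-- The transitions of a derivation; a bit axiom counts as a transition that emits a token. -/
inductive Hyper (π : Deriv 𝒰 Γ M A) : Set (Occ π) → Set (Occ π) → Prop
  | move {o o' : Occ π} (h : Move π o o') : Hyper π {o} {o'}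
  | gate (g : Gate 𝒰 (Occ π)) (hg : g ∈ gates π) : Hyper π (Set.range g.arg) (Set.range g.res)
  | bit (l : BitLeaf (Occ π)) (hl : l ∈ bitLeaves π) : Hyper π ∅ {l.occ}

theorem Hyper.gate' {π : Deriv 𝒰 Γ M A} {I X : Set (Occ π)} (g : Gate 𝒰 (Occ π))
    (hg : g ∈ gates π) (hI : Set.range g.arg = I) (hX : Set.range g.res = X) : Hyper π I X := by
  subst hI hX
  exact .gate g hg

theorem Hyper.bit' {π : Deriv 𝒰 Γ M A} {I X : Set (Occ π)} (l : BitLeaf (Occ π))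
    (hl : l ∈ bitLeaves π) (hI : ∅ = I) (hX : {l.occ} = X) : Hyper π I X := by
  subst hI hX
  exact .bit l hl

theorem LinkHyper.prem' {J P JP O : Type} {e : J ⊕ P ≃ O} {ent : J → Bool} {r : JP → P}
    {φ : J → JP} {κ : JP → JP → Prop} {H : Set P → Set P → Prop} {I X : Set P} {I' X' : Set O}
    (h : H I X) (hI : (fun p => e (.inr p)) '' I = I') (hX : (fun p => e (.inr p)) '' X = X') :
    LinkHyper e ent r φ κ H I' X' := by
  subst hI hX
  exact .prem h

/-- Unitary and bit axioms sit only at the leaves, so a rule with a premise adds nothing but links;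
`hyper_binary` is the version for two premises. -/
theorem hyper_unary {J JP : Type} {ent : J → Bool} {φ : J → JP}
    {κ : JP → JP → Prop} {π : Deriv 𝒰 Γ M A} {δ : Deriv 𝒰 Θ L E} {e : J ⊕ Occ π ≃ Occ δ}
    {r : JP → Occ π}
    (hm : ∀ o o', Move δ o o' ↔ (∃ p p', Move π p p' ∧ e (.inr p) = o ∧ e (.inr p') = o') ∨
      Link e ent r φ κ o o')
    (hg : gates δ = (gates π).map (Gate.map fun p => e (.inr p)))
    (hb : bitLeaves δ = (bitLeaves π).map (BitLeaf.map fun p => e (.inr p))) (I X : Set (Occ δ)) :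
    Hyper δ I X ↔ LinkHyper e ent r φ κ (Hyper π) I X := by
  constructor
  · rintro (⟨h⟩ | ⟨g, h⟩ | ⟨l, h⟩)
    · rcases (hm _ _).1 h with ⟨p, p', hp, rfl, rfl⟩ | h
      · exact .prem' (.move hp) (by simp) (by simp)
      · exact .link h
    · rw [hg] at h
      obtain ⟨g, hg', rfl⟩ := List.mem_map.1 h
      exact .prem' (.gate g hg') (Set.range_comp _ _).symm (Set.range_comp _ _).symm
    · rw [hb] at h
      obtain ⟨l, hl', rfl⟩ := List.mem_map.1 h
      exact .prem' (.bit l hl') (by simp) (by simp [BitLeaf.map])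
  · rintro (⟨h⟩ | ⟨h⟩)
    · rcases h with ⟨h⟩ | ⟨g, h⟩ | ⟨l, h⟩
      · simp only [Set.image_singleton]
        exact .move ((hm _ _).2 (.inl ⟨_, _, h, rfl, rfl⟩))
      · exact .gate' (g.map fun p => e (.inr p)) (hg ▸ List.mem_map_of_mem h)
          (Set.range_comp (fun p => e (.inr p)) g.arg) (Set.range_comp (fun p => e (.inr p)) g.res)
      · exact .bit' (l.map fun p => e (.inr p)) (hb ▸ List.mem_map_of_mem h) (by simp)
          (by simp [BitLeaf.map])
    · exact .move ((hm _ _).2 (.inr h))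

theorem hyper_binary {J JP : Type} {ent : J → Bool} {φ : J → JP}
    {κ : JP → JP → Prop} {π : Deriv 𝒰 Γ M A} {ρ : Deriv 𝒰 Δ N B} {δ : Deriv 𝒰 Θ L E}
    {e : J ⊕ (Occ π ⊕ Occ ρ) ≃ Occ δ} {r : JP → Occ π ⊕ Occ ρ}
    (hm : ∀ o o', Move δ o o' ↔ (∃ p p', Sum.LiftRel (Move π) (Move ρ) p p' ∧
      e (.inr p) = o ∧ e (.inr p') = o') ∨ Link e ent r φ κ o o')
    (hg : gates δ = (gates π).map (Gate.map fun p => e (.inr (.inl p))) ++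
      (gates ρ).map (Gate.map fun p => e (.inr (.inr p))))
    (hb : bitLeaves δ = (bitLeaves π).map (BitLeaf.map fun p => e (.inr (.inl p))) ++
      (bitLeaves ρ).map (BitLeaf.map fun p => e (.inr (.inr p)))) (I X : Set (Occ δ)) :
    Hyper δ I X ↔ LinkHyper e ent r φ κ (SumHyper (Hyper π) (Hyper ρ)) I X := by
  constructor
  · rintro (⟨h⟩ | ⟨g, h⟩ | ⟨l, h⟩)
    · rcases (hm _ _).1 h with ⟨p, p', hp, rfl, rfl⟩ | h
      · cases hp with
        | inl hp => exact .prem' (.inl (.move hp)) (by simp) (by simp)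
        | inr hp => exact .prem' (.inr (.move hp)) (by simp) (by simp)
      · exact .link h
    · rw [hg] at h
      rcases List.mem_append.1 h with h | h <;> obtain ⟨g, hg', rfl⟩ := List.mem_map.1 h
      · exact .prem' (.inl (.gate g hg')) (by rw [Set.image_image, ← Set.range_comp]; rfl)
          (by rw [Set.image_image, ← Set.range_comp]; rfl)
      · exact .prem' (.inr (.gate g hg')) (by rw [Set.image_image, ← Set.range_comp]; rfl)
          (by rw [Set.image_image, ← Set.range_comp]; rfl)
    · rw [hb] at h
      rcases List.mem_append.1 h with h | h <;> obtain ⟨l, hl', rfl⟩ := List.mem_map.1 h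
      · exact .prem' (.inl (.bit l hl')) (by simp) (by simp [BitLeaf.map])
      · exact .prem' (.inr (.bit l hl')) (by simp) (by simp [BitLeaf.map])
  · rintro (⟨⟨h⟩ | ⟨h⟩⟩ | ⟨h⟩)
    · rw [Set.image_image, Set.image_image]
      rcases h with ⟨h⟩ | ⟨g, h⟩ | ⟨l, h⟩
      · simp only [Set.image_singleton]
        exact .move ((hm _ _).2 (.inl ⟨_, _, .inl h, rfl, rfl⟩))
      · exact .gate' (g.map fun p => e (.inr (.inl p)))
          (hg ▸ List.mem_append_left _ (List.mem_map_of_mem h))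
          (Set.range_comp (fun p => e (.inr (.inl p))) g.arg) (Set.range_comp (fun p => e (.inr (.inl p))) g.res)
      · exact .bit' (l.map fun p => e (.inr (.inl p)))
          (hb ▸ List.mem_append_left _ (List.mem_map_of_mem h)) (by simp) (by simp [BitLeaf.map])
    · rw [Set.image_image, Set.image_image]
      rcases h with ⟨h⟩ | ⟨g, h⟩ | ⟨l, h⟩
      · simp only [Set.image_singleton]
        exact .move ((hm _ _).2 (.inl ⟨_, _, .inr h, rfl, rfl⟩))
      · exact .gate' (g.map fun p => e (.inr (.inr p)))
          (hg ▸ List.mem_append_right _ (List.mem_map_of_mem h))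
          (Set.range_comp (fun p => e (.inr (.inr p))) g.arg) (Set.range_comp (fun p => e (.inr (.inr p))) g.res)
      · exact .bit' (l.map fun p => e (.inr (.inr p)))
          (hb ▸ List.mem_append_right _ (List.mem_map_of_mem h)) (by simp) (by simp [BitLeaf.map])
    · exact .move ((hm _ _).2 (.inr h))

theorem Hole.pow_sign : ∀ n (k : Fin n), (Hole.pow n k).sign = true
  | 0, k => k.elim0
  | 1, _ => rfl
  | n + 2, k => by
    refine Fin.cases ?_ (fun j => ?_) k
    · rfl
    · exact Hole.pow_sign (n + 1) j

theorem Hole.pow_injective : ∀ n, (Hole.pow n).Injective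
  | 0 => fun k => k.elim0
  | 1 => fun _ _ _ => Subsingleton.elim _ _
  | n + 2 => by
    intro k k'
    refine Fin.cases ?_ (fun j => ?_) k <;> refine Fin.cases ?_ (fun j' => ?_) k' <;> intro h
    · rfl
    · cases h
    · cases h
    · exact congrArg Fin.succ (Hole.pow_injective (n + 1) (Hole.tensR.inj h))

/-- Positivity matters: at `0` the type is by default `bit`, which has a hole, while `Fin 0` is
empty. -/
theorem Hole.pow_surjective : ∀ n, 0 < n → (Hole.pow n).Surjective
  | 1, _ => fun C => ⟨0, by cases C; rfl⟩
  | n + 2, _ => by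
    intro C
    cases C with
    | tensL C =>
      cases C
      exact ⟨0, rfl⟩
    | tensR C =>
      obtain ⟨k, rfl⟩ := Hole.pow_surjective (n + 1) n.succ_pos C
      exact ⟨k.succ, rfl⟩

theorem half_of_rel {J : Type} {ent : J → Bool} {m : J → J → Prop} {H : Set J → Set J → Prop}
    (hH : ∀ I X, H I X ↔ ∃ o o', m o o' ∧ I = {o} ∧ X = {o'})
    (hu : ∀ {o a b}, m o a → m o b → a = b) (he : ∀ {o a}, m o a → ent o = true)
    (ht : ∀ o, ent o = true → ∃ a, m o a) : Half (fun j => j) ent H where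
  uniq := by
    intro I X I' X' o h h' ho ho'
    obtain ⟨a, b, hm, rfl, rfl⟩ := (hH _ _).1 h
    obtain ⟨a', b', hm', rfl, rfl⟩ := (hH _ _).1 h'
    rw [Set.mem_singleton_iff] at ho ho'
    subst ho ho'
    rw [hu hm hm']
    exact ⟨rfl, rfl⟩
  entry := by
    intro I X j h hj
    obtain ⟨a, b, hm, rfl, rfl⟩ := (hH _ _).1 h
    rw [Set.mem_singleton_iff] at hj
    subst hj
    exact he hm
  total := by
    intro o
    cases ho : ent o
    · exact .inl ⟨o, ho, rfl⟩
    · obtain ⟨a, ha⟩ := ht o ho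
      exact .inr ⟨_, _, (hH _ _).2 ⟨o, a, ha, rfl, rfl⟩, rfl⟩

theorem full_var (x : ℕ) (A : Ty) :
    Full (root (Deriv.var (𝒰 := 𝒰) x A)) JOcc.entry (Hyper (Deriv.var (𝒰 := 𝒰) x A)) := by
  have hH : ∀ I X, Hyper (Deriv.var (𝒰 := 𝒰) x A) I X ↔
      ∃ o o', VarMove x A o o' ∧ I = {o} ∧ X = {o'} := by
    intro I X
    constructor
    · rintro (⟨h⟩ | ⟨g, h⟩ | ⟨l, h⟩)
      · exact ⟨_, _, h, rfl, rfl⟩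
      · simp [gates] at h
      · simp [bitLeaves] at h
    · rintro ⟨o, o', h, rfl, rfl⟩
      exact .move h
  constructor
  · refine half_of_rel hH ?_ ?_ ?_
    · intro o a b h h'
      cases h <;> cases h' <;> rfl
    · rintro o a (⟨C, h, hC⟩ | ⟨C, h, hC⟩)
      · exact hC
      · simpa [JOcc.entry, Hole.Neg] using hC
    · rintro (⟨z, D, h, C⟩ | C) ho
      · obtain ⟨rfl, rfl⟩ := lookup_singleton h
        exact ⟨_, .pos C h ho⟩
      · exact ⟨_, .neg C Finmap.lookup_singleton_eq (by simpa [JOcc.entry, Hole.Neg] using ho)⟩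
  · refine half_of_rel (m := Function.swap (VarMove x A)) (fun I X => (hH X I).trans ?_) ?_ ?_ ?_
    · constructor
      · rintro ⟨o, o', h, rfl, rfl⟩
        exact ⟨_, _, h, rfl, rfl⟩
      · rintro ⟨o, o', h, rfl, rfl⟩
        exact ⟨_, _, h, rfl, rfl⟩
    · intro o a b h h'
      cases h <;> cases h' <;> rfl
    · rintro o a (⟨C, h, hC⟩ | ⟨C, h, hC⟩)
      · simpa [JOcc.entry, Hole.Pos] using hC
      · simpa [JOcc.entry, Hole.Neg] using hC
    · rintro (⟨z, D, h, C⟩ | C) ho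
      · obtain ⟨rfl, rfl⟩ := lookup_singleton h
        exact ⟨_, .neg C h (by simpa [JOcc.entry, Hole.Neg] using ho)⟩
      · exact ⟨_, .pos C Finmap.lookup_singleton_eq (by simpa [JOcc.entry, Hole.Pos] using ho)⟩

/-- The single occurrence is an exit, hence needs an incoming transition: the emission from the
empty set, introduced in `Hyper` for this purpose. -/
theorem full_bit (b : Bool) (n : ℕ) :
    Full (root (Deriv.bit (𝒰 := 𝒰) b n)) JOcc.entry (Hyper (Deriv.bit (𝒰 := 𝒰) b n)) := by
  have hH : ∀ {I X}, Hyper (Deriv.bit (𝒰 := 𝒰) b n) I X → I = ∅ ∧ X = {JOcc.goal .here} := by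
    rintro I X (⟨h⟩ | ⟨g, h⟩ | ⟨l, h⟩)
    · exact h.elim
    · simp [gates] at h
    · simp only [bitLeaves, List.mem_singleton] at h
      subst h
      exact ⟨rfl, rfl⟩
  have hO : ∀ j : JOcc ∅ .bit, j = .goal .here := by
    rintro (⟨z, D, h, C⟩ | C)
    · simp at h
    · cases C
      rfl
  constructor
  · refine ⟨fun h _ ho _ => ?_, fun h hj => ?_, fun o => .inl ⟨.goal .here, rfl, (hO o).symm⟩⟩
    · rw [(hH h).1] at ho
      exact ho.elim
    · rw [(hH h).1] at hj
      exact hj.elim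
  · refine ⟨fun h h' _ _ => ?_, fun {_ _ j} _ _ => ?_, fun o => .inr ⟨_, _, .bit _ (.head _), hO o⟩⟩
    · rw [(hH h).1, (hH h).2, (hH h').1, (hH h').2]
      exact ⟨rfl, rfl⟩
    · rw [hO j]
      rfl

theorem full_unitary (U : 𝒰.Sym) :
    Full (root (Deriv.unitary U)) JOcc.entry (Hyper (Deriv.unitary U)) := by
  have hH : ∀ {I X}, Hyper (Deriv.unitary U) I X →
      I = Set.range (fun k => JOcc.goal (.lolliL (Hole.pow (𝒰.arity U) k))) ∧
      X = Set.range (fun k => JOcc.goal (.lolliR (Hole.pow (𝒰.arity U) k))) := by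
    rintro I X (⟨h⟩ | ⟨g, h⟩ | ⟨l, h⟩)
    · exact h.elim
    · simp only [gates, List.mem_singleton] at h
      subst h
      exact ⟨rfl, rfl⟩
    · simp [bitLeaves] at h
  have hO : ∀ j : JOcc ∅ (.lolli (Ty.pow (𝒰.arity U)) (Ty.pow (𝒰.arity U))),
      (j.entry = true ∧ ∃ k, JOcc.goal (.lolliL (Hole.pow _ k)) = j) ∨
      (j.entry = false ∧ ∃ k, JOcc.goal (.lolliR (Hole.pow _ k)) = j) := by
    rintro (⟨z, D, h, C⟩ | C)
    · simp at h
    · cases C with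
      | lolliL C =>
        obtain ⟨k, rfl⟩ := Hole.pow_surjective _ (𝒰.arity_pos U) C
        exact .inl ⟨by simp [JOcc.entry, Hole.sign, Hole.pow_sign], k, rfl⟩
      | lolliR C =>
        obtain ⟨k, rfl⟩ := Hole.pow_surjective _ (𝒰.arity_pos U) C
        exact .inr ⟨by simp [JOcc.entry, Hole.sign, Hole.pow_sign], k, rfl⟩
  constructor
  · refine ⟨fun h h' _ _ => ?_, fun {_ _ j} h hj => ?_, fun o => ?_⟩
    · rw [(hH h).1, (hH h).2, (hH h').1, (hH h').2]
      exact ⟨rfl, rfl⟩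
    · rw [(hH h).1] at hj
      obtain ⟨k, rfl⟩ := hj
      simp [JOcc.entry, Hole.sign, Hole.pow_sign]
    · rcases hO o with ⟨-, ho⟩ | ⟨ho, -⟩
      · exact .inr ⟨_, _, .gate _ (.head _), ho⟩
      · exact .inl ⟨o, ho, rfl⟩
  · refine ⟨fun h h' _ _ => ?_, fun {_ _ j} h hj => ?_, fun o => ?_⟩
    · rw [(hH h).1, (hH h).2, (hH h').1, (hH h').2]
      exact ⟨rfl, rfl⟩
    · rw [(hH h).2] at hj
      obtain ⟨k, rfl⟩ := hj
      simp [JOcc.entry, Hole.sign, Hole.pow_sign]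
    · rcases hO o with ⟨ho, -⟩ | ⟨-, ho⟩
      · exact .inl ⟨o, by simp [ho], rfl⟩
      · exact .inr ⟨_, _, .gate _ (.head _), ho⟩

/-- The machine is deterministic and reversible at each occurrence: only one transition can consume
a token there and only one can deliver it. -/
theorem full : ∀ {Γ : Env} {M : Term 𝒰} {A : Ty} (π : Deriv 𝒰 Γ M A),
    Full (root π) JOcc.entry (Hyper π)
  | _, _, _, .var x A => full_var x A
  | _, _, _, .bit b n => full_bit b n
  | _, _, _, .unitary U => full_unitary U
  | _, _, _, .lam x A hx π =>
    ((full π).link (e := Occ₁.equiv _ _) (lamPort_wiring hx) (root_injective π)).congr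
      (hyper_unary (δ := .lam x A hx π) (lamMove_iff hx _ _) rfl rfl)
  | _, _, _, .lamPair x y A B hx hy hxy π =>
    ((full π).link (e := Occ₁.equiv _ _) (lamPairPort_wiring hx hy hxy) (root_injective π)).congr
      (hyper_unary (δ := .lamPair x y A B hx hy hxy π) (lamPairMove_iff hx hy hxy _ _) rfl rfl)
  | _, _, _, .app hΓΔ π ρ =>
    (((full π).sum (full ρ)).link (e := Occ₂.equiv _ _ _) (appPort_wiring hΓΔ)
      ((root_injective π).sumMap (root_injective ρ))).congr
      (hyper_binary (δ := .app hΓΔ π ρ) (appMove_iff hΓΔ _ _ _ _) rfl rfl)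
  | _, _, _, .tens hΓΔ π ρ =>
    (((full π).sum (full ρ)).link (e := Occ₂.equiv _ _ _) (tensPort_wiring hΓΔ)
      ((root_injective π).sumMap (root_injective ρ))).congr
      (hyper_binary (δ := .tens hΓΔ π ρ) (tensMove_iff hΓΔ _ _ _ _) rfl rfl)

/-- Needed to fire an axiom: its argument tokens then have distinct positions in the state, and the
tokens moved to its results stay on distinct occurrences. -/
theorem gate_injective : ∀ {Γ : Env} {M : Term 𝒰} {A : Ty} (π : Deriv 𝒰 Γ M A),
    ∀ g ∈ gates π, g.arg.Injective ∧ g.res.Injective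
  | _, _, _, .var _ _, g, hg => by simp [gates] at hg
  | _, _, _, .bit _ _, g, hg => by simp [gates] at hg
  | _, _, _, .unitary U, g, hg => by
    simp only [gates, List.mem_singleton] at hg
    subst hg
    exact ⟨fun k k' h => Hole.pow_injective _ (Hole.lolliL.inj (JOcc.goal.inj h)),
      fun k k' h => Hole.pow_injective _ (Hole.lolliR.inj (JOcc.goal.inj h))⟩
  | _, _, _, .lam _ _ _ π, g, hg => by
    obtain ⟨g, hg', rfl⟩ := List.mem_map.1 hg
    obtain ⟨h1, h2⟩ := gate_injective π g hg'
    exact ⟨fun _ _ h => h1 (Occ₁.prem.inj h), fun _ _ h => h2 (Occ₁.prem.inj h)⟩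
  | _, _, _, .lamPair _ _ _ _ _ _ _ π, g, hg => by
    obtain ⟨g, hg', rfl⟩ := List.mem_map.1 hg
    obtain ⟨h1, h2⟩ := gate_injective π g hg'
    exact ⟨fun _ _ h => h1 (Occ₁.prem.inj h), fun _ _ h => h2 (Occ₁.prem.inj h)⟩
  | _, _, _, .app _ π ρ, g, hg => by
    rcases List.mem_append.1 hg with hg | hg <;> obtain ⟨g, hg', rfl⟩ := List.mem_map.1 hg
    · obtain ⟨h1, h2⟩ := gate_injective π g hg'
      exact ⟨fun _ _ h => h1 (Occ₂.left.inj h), fun _ _ h => h2 (Occ₂.left.inj h)⟩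
    · obtain ⟨h1, h2⟩ := gate_injective ρ g hg'
      exact ⟨fun _ _ h => h1 (Occ₂.right.inj h), fun _ _ h => h2 (Occ₂.right.inj h)⟩
  | _, _, _, .tens _ π ρ, g, hg => by
    rcases List.mem_append.1 hg with hg | hg <;> obtain ⟨g, hg', rfl⟩ := List.mem_map.1 hg
    · obtain ⟨h1, h2⟩ := gate_injective π g hg'
      exact ⟨fun _ _ h => h1 (Occ₂.left.inj h), fun _ _ h => h2 (Occ₂.left.inj h)⟩
    · obtain ⟨h1, h2⟩ := gate_injective ρ g hg'
      exact ⟨fun _ _ h => h1 (Occ₂.right.inj h), fun _ _ h => h2 (Occ₂.right.inj h)⟩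

theorem nodup_map_bitLeaf {O O' : Type} {f : O → O'} (hf : f.Injective) {l : List (BitLeaf O)}
    (hl : (l.map BitLeaf.occ).Nodup) : ((l.map (BitLeaf.map f)).map BitLeaf.occ).Nodup := by
  have : (l.map (BitLeaf.map f)).map BitLeaf.occ = (l.map BitLeaf.occ).map f := by
    simp [BitLeaf.map]
  rw [this]
  exact hl.map hf

theorem nodup_map_bitLeaf_append {O₁ O₂ O' : Type} {f : O₁ → O'} {g : O₂ → O'}
    (hf : f.Injective) (hg : g.Injective) (hfg : ∀ a b, f a ≠ g b) {l : List (BitLeaf O₁)}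
    {l' : List (BitLeaf O₂)} (hl : (l.map BitLeaf.occ).Nodup) (hl' : (l'.map BitLeaf.occ).Nodup) :
    ((l.map (BitLeaf.map f) ++ l'.map (BitLeaf.map g)).map BitLeaf.occ).Nodup := by
  rw [List.map_append, List.nodup_append]
  refine ⟨nodup_map_bitLeaf hf hl, nodup_map_bitLeaf hg hl', ?_⟩
  intro a ha b hb
  simp only [List.map_map, List.mem_map, Function.comp_apply, BitLeaf.map] at ha hb
  obtain ⟨a, -, rfl⟩ := ha
  obtain ⟨b, -, rfl⟩ := hb
  exact hfg _ _

theorem nodup_bitLeaves : ∀ {Γ : Env} {M : Term 𝒰} {A : Ty} (π : Deriv 𝒰 Γ M A),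
    ((bitLeaves π).map BitLeaf.occ).Nodup
  | _, _, _, .var _ _ => List.nodup_nil
  | _, _, _, .bit _ _ => List.nodup_singleton _
  | _, _, _, .unitary _ => List.nodup_nil
  | _, _, _, .lam _ _ _ π => by
    exact nodup_map_bitLeaf (fun _ _ h => Occ₁.prem.inj h) (nodup_bitLeaves π)
  | _, _, _, .lamPair _ _ _ _ _ _ _ π => by
    exact nodup_map_bitLeaf (fun _ _ h => Occ₁.prem.inj h) (nodup_bitLeaves π)
  | _, _, _, .app _ π ρ => by
    exact nodup_map_bitLeaf_append (fun _ _ h => Occ₂.left.inj h)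
      (fun _ _ h => Occ₂.right.inj h) (fun _ _ => nofun) (nodup_bitLeaves π) (nodup_bitLeaves ρ)
  | _, _, _, .tens _ π ρ => by
    exact nodup_map_bitLeaf_append (fun _ _ h => Occ₂.left.inj h)
      (fun _ _ h => Occ₂.right.inj h) (fun _ _ => nofun) (nodup_bitLeaves π) (nodup_bitLeaves ρ)

end Derivations

/-! ### Sequences of occurrences -/

theorem mem_holes : ∀ {A : Ty} {s : Bool} {C : Hole A}, C ∈ holes s A ↔ C.sign = s
  | .bit, s, C => by
    cases C
    cases s <;> simp [holes, Hole.sign]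
  | .tens A B, s, C => by
    cases C <;> simp [holes, Hole.sign, mem_holes (A := A), mem_holes (A := B)]
  | .lolli A B, s, C => by
    cases C with
    | lolliL C => cases s <;> simp [holes, Hole.sign, mem_holes (A := A)]
    | lolliR C => simp [holes, Hole.sign, mem_holes (A := B)]

theorem nodup_holes : ∀ {A : Ty} {s : Bool}, (holes s A).Nodup
  | .bit, true => List.nodup_singleton _
  | .bit, false => List.nodup_nil
  | .tens A B, s => by
    rw [holes, List.nodup_append]
    refine ⟨nodup_holes.map fun _ _ => Hole.tensL.inj, nodup_holes.map fun _ _ => Hole.tensR.inj, ?_⟩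
    intro C hC D hD
    obtain ⟨C, -, rfl⟩ := List.mem_map.1 hC
    obtain ⟨D, -, rfl⟩ := List.mem_map.1 hD
    exact nofun
  | .lolli A B, s => by
    rw [holes, List.nodup_append]
    refine ⟨nodup_holes.map fun _ _ => Hole.lolliL.inj,
      nodup_holes.map fun _ _ => Hole.lolliR.inj, ?_⟩
    intro C hC D hD
    obtain ⟨C, -, rfl⟩ := List.mem_map.1 hC
    obtain ⟨D, -, rfl⟩ := List.mem_map.1 hD
    exact nofun

section Sequences

variable {𝒰 : Signature} {Γ : Env} {M : Term 𝒰} {A : Ty}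

theorem mem_envOccs {s : Bool} {o : JOcc Γ A} :
    o ∈ envOccs s Γ A ↔ ∃ x B h C, Hole.sign C = s ∧ JOcc.hyp x B h C = o := by
  rw [envOccs, List.mem_flatMap]
  constructor
  · rintro ⟨x, -, ho⟩
    split at ho
    · rename_i B h
      obtain ⟨C, hC, rfl⟩ := List.mem_map.1 ho
      exact ⟨x, B, h, C, mem_holes.1 hC, rfl⟩
    · cases ho
  · rintro ⟨x, B, h, C, hC, rfl⟩
    refine ⟨x, (Finset.mem_sort _).2 (Finmap.mem_keys.2 (Finmap.mem_of_lookup_eq_some h)), ?_⟩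
    split
    · rename_i B' h'
      obtain rfl : B = B' := Option.some.inj (h.symm.trans h')
      exact List.mem_map_of_mem (mem_holes.2 hC)
    · rename_i h'
      rw [h] at h'
      cases h'

theorem nodup_envOccs {s : Bool} : (envOccs s Γ A).Nodup := by
  rw [envOccs, List.nodup_flatMap]
  constructor
  · intro x _
    split
    · refine nodup_holes.map fun C D h => ?_
      cases h
      rfl
    · exact List.nodup_nil
  · refine (Finset.sort_nodup Γ.keys (· ≤ ·)).imp fun {x y} hxy => ?_
    intro o hx hy
    beta_reduce at hx hy
    split at hx
    · split at hy
      · obtain ⟨C, -, rfl⟩ := List.mem_map.1 hx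
        obtain ⟨D, -, h⟩ := List.mem_map.1 hy
        cases h
        exact hxy rfl
      · cases hy
    · cases hx

/-- Identifies the lists defining inputs and outputs with the entries and exits of the concluding
judgement. -/
theorem mem_ports {s : Bool} {j : JOcc Γ A} :
    j ∈ envOccs s Γ A ++ (holes (!s) A).map JOcc.goal ↔ j.entry = s := by
  rw [List.mem_append, mem_envOccs, List.mem_map]
  constructor
  · rintro (⟨x, B, h, C, hC, rfl⟩ | ⟨C, hC, rfl⟩)
    · exact hC
    · simp [JOcc.entry, mem_holes.1 hC]
  · intro h
    cases j with
    | hyp x B hx C => exact .inl ⟨x, B, hx, C, h, rfl⟩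
    | goal C => exact .inr ⟨C, mem_holes.2 (by rw [← h]; simp [JOcc.entry]), rfl⟩

theorem nodup_ports {s s' : Bool} :
    (envOccs s Γ A ++ (holes s' A).map (JOcc.goal (Γ := Γ))).Nodup := by
  rw [List.nodup_append]
  refine ⟨nodup_envOccs, nodup_holes.map fun _ _ => JOcc.goal.inj, ?_⟩
  intro j hj j' hj'
  obtain ⟨x, B, h, C, -, rfl⟩ := mem_envOccs.1 hj
  obtain ⟨C, -, rfl⟩ := List.mem_map.1 hj'
  exact nofun

theorem mem_inputs {π : Deriv 𝒰 Γ M A} {o : Occ π} :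
    o ∈ inputs π ↔ ∃ j, JOcc.entry j = true ∧ root π j = o := by
  simp only [inputs, List.mem_map, ← mem_ports (s := true), Bool.not_true]

theorem mem_outputs {π : Deriv 𝒰 Γ M A} {o : Occ π} :
    o ∈ outputs π ↔ ∃ j, JOcc.entry j = false ∧ root π j = o := by
  simp only [outputs, List.mem_map, ← mem_ports (s := false), Bool.not_false]

theorem nodup_inputs (π : Deriv 𝒰 Γ M A) : (inputs π).Nodup := nodup_ports.map (root_injective π)

theorem nodup_outputs (π : Deriv 𝒰 Γ M A) : (outputs π).Nodup := nodup_ports.map (root_injective π)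

theorem mem_sortedBits {π : Deriv 𝒰 Γ M A} {l : BitLeaf (Occ π)} :
    l ∈ sortedBits π ↔ l ∈ bitLeaves π := (List.mergeSort_perm _ _).mem_iff

theorem nodup_sortedBits (π : Deriv 𝒰 Γ M A) : ((sortedBits π).map BitLeaf.occ).Nodup :=
  ((List.mergeSort_perm _ _).map _).nodup_iff.2 (nodup_bitLeaves π)

instance finite_jOcc (Γ : Env) (A : Ty) : Finite (JOcc Γ A) := by
  refine Set.finite_univ_iff.1 (((List.finite_toSet
    (envOccs true Γ A ++ (holes (!true) A).map JOcc.goal)).union (List.finite_toSet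
    (envOccs false Γ A ++ (holes (!false) A).map JOcc.goal))).subset fun j _ => ?_)
  cases hj : j.entry
  · exact .inr (mem_ports.2 hj)
  · exact .inl (mem_ports.2 hj)

theorem finite_occ : ∀ {Γ : Env} {M : Term 𝒰} {A : Ty} (π : Deriv 𝒰 Γ M A), Finite (Occ π)
  | _, _, _, .var _ _ => finite_jOcc _ _
  | _, _, _, .bit _ _ => finite_jOcc _ _
  | _, _, _, .unitary _ => finite_jOcc _ _
  | _, _, _, .lam _ _ _ π => by
    have := finite_occ π
    exact Finite.of_equiv _ (Occ₁.equiv _ _)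
  | _, _, _, .lamPair _ _ _ _ _ _ _ π => by
    have := finite_occ π
    exact Finite.of_equiv _ (Occ₁.equiv _ _)
  | _, _, _, .app _ π ρ => by
    have := finite_occ π
    have := finite_occ ρ
    exact Finite.of_equiv _ (Occ₂.equiv _ _ _)
  | _, _, _, .tens _ π ρ => by
    have := finite_occ π
    have := finite_occ ρ
    exact Finite.of_equiv _ (Occ₂.equiv _ _ _)

end Sequences

/-! ### Norms of registers -/

theorem norm_tensBasis {k l : ℕ} (v : QSpace k) (b : Fin l → Bool) : ‖tensBasis v b‖ = ‖v‖ := by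
  rw [← sq_eq_sq₀ (norm_nonneg _) (norm_nonneg _), EuclideanSpace.norm_sq_eq,
    EuclideanSpace.norm_sq_eq, ← (Fin.appendEquiv k l).sum_comp, Fintype.sum_prod_type]
  refine Finset.sum_congr rfl fun a _ => ?_
  rw [Finset.sum_eq_single b]
  · simp [tensBasis, Fin.appendEquiv]
  · intro c _ hc
    simp [tensBasis, Fin.appendEquiv, hc]
  · simp

theorem sum_norm_sq_mulVec {m : Type*} [Fintype m] [DecidableEq m] (U : Matrix.unitaryGroup m ℂ)
    (w : m → ℂ) : ∑ a, ‖∑ c, U.1 a c * w c‖ ^ 2 = ∑ a, ‖w a‖ ^ 2 := by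
  have key : ∀ u : m → ℂ, ((∑ a, ‖u a‖ ^ 2 : ℝ) : ℂ) = star u ⬝ᵥ u := by
    intro u
    simp [dotProduct, Complex.conj_mul']
  have h : star (U.1.mulVec w) ⬝ᵥ U.1.mulVec w = star w ⬝ᵥ w := by
    rw [Matrix.star_mulVec, Matrix.dotProduct_mulVec, Matrix.vecMul_vecMul, ← Matrix.star_eq_conjTranspose,
      Matrix.UnitaryGroup.star_mul_self, Matrix.vecMul_one]
  have h2 := (key (U.1.mulVec w)).trans (h.trans (key w).symm)
  exact_mod_cast h2

/-- Split a bit string into its entries at the positions `i` and the others. For each fixed choice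
`d` of the others, the operator acts on the fibre as the unitary matrix `U`; sum the squared norms
over the fibres. -/
theorem norm_applyAt {m n : ℕ} (U : Matrix.unitaryGroup (Fin m → Bool) ℂ) (i : Fin m ↪ Fin n)
    (v : QSpace n) : ‖applyAt U.1 i v‖ = ‖v‖ := by
  classical
  let E : (Fin m → Bool) × ({j // j ∉ Set.range i} → Bool) ≃ (Fin n → Bool) :=
    ((Equiv.arrowCongr (Equiv.ofInjective i i.injective) (Equiv.refl Bool)).prodCongr
      (Equiv.refl _)).trans (Equiv.piEquivPiSubtypeProd (· ∈ Set.range i) fun _ => Bool).symm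
  have hE1 : ∀ a d, E (a, d) ∘ i = a := by
    intro a d
    funext k
    simp [E, Equiv.piEquivPiSubtypeProd]
  have hE2 : ∀ a c d, Function.extend i c (E (a, d)) = E (c, d) := by
    intro a c d
    funext j
    by_cases hj : ∃ k, i k = j
    · obtain ⟨k, rfl⟩ := hj
      rw [i.injective.extend_apply]
      exact (congrFun (hE1 c d) k).symm
    · rw [Function.extend_apply' _ _ _ hj]
      simp [E, Equiv.piEquivPiSubtypeProd, hj]
  rw [← sq_eq_sq₀ (norm_nonneg _) (norm_nonneg _), EuclideanSpace.norm_sq_eq,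
    EuclideanSpace.norm_sq_eq, ← E.sum_comp, ← E.sum_comp, Fintype.sum_prod_type_right,
    Fintype.sum_prod_type_right]
  refine Finset.sum_congr rfl fun d _ => ?_
  refine Eq.trans ?_ (sum_norm_sq_mulVec U fun a => v (E (a, d)))
  simp [applyAt, hE1, hE2]

section Machine

variable {𝒰 : Signature} {Γ : Env} {M : Term 𝒰} {A : Ty} {π : Deriv 𝒰 Γ M A} {n : ℕ}

/-! ### Transitions and steps of the machine -/

theorem Hyper.edge {I X : Set (Occ π)} (h : Hyper π I X) {a b : Occ π} (ha : a ∈ I)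
    (hb : b ∈ X) : Edge π a b := by
  rcases h with ⟨h⟩ | ⟨g, hg⟩ | ⟨l, hl⟩
  · rw [Set.mem_singleton_iff] at ha hb
    subst ha hb
    exact .move h
  · obtain ⟨k, rfl⟩ := ha
    obtain ⟨k', rfl⟩ := hb
    exact .gate g hg k k'
  · exact ha.elim

theorem Hyper.nonempty {I X : Set (Occ π)} (h : Hyper π I X) : X.Nonempty := by
  rcases h with ⟨h⟩ | ⟨g, hg⟩ | ⟨l, hl⟩
  · exact Set.singleton_nonempty _
  · exact ⟨_, ⟨0, 𝒰.arity_pos g.sym⟩, rfl⟩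
  · exact Set.singleton_nonempty _

/-- Forgets the register and the order of tokens: a step replaces the sources of a transition by its
targets in the occupied set. Emissions by bit axioms are not steps, so the source is nonempty. -/
theorem Step.hyper {S T : State π n} (h : Step S T) : ∃ I X, Hyper π I X ∧ I.Nonempty ∧
    I ⊆ Set.range S.occ ∧ Set.range T.occ = (Set.range S.occ \ I) ∪ X := by
  rcases h with ⟨j, hj, hne, -⟩ | ⟨g, hg, i, harg, hres, hne, -⟩
  · refine ⟨_, _, .move hj, Set.singleton_nonempty _, ?_, ?_⟩
    · rintro _ rfl
      exact ⟨j, rfl⟩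
    · ext o
      constructor
      · rintro ⟨j', rfl⟩
        by_cases hj' : j' = j
        · exact .inr (by rw [hj']; rfl)
        · rw [hne j' hj']
          exact .inl ⟨⟨j', rfl⟩, fun h => hj' (S.occ.injective h)⟩
      · rintro (⟨⟨j', rfl⟩, h⟩ | rfl)
        · exact ⟨j', hne j' fun h' => h (by rw [h']; rfl)⟩
        · exact ⟨j, rfl⟩
  · refine ⟨_, _, .gate g hg, ⟨_, ⟨0, 𝒰.arity_pos g.sym⟩, rfl⟩, ?_, ?_⟩
    · rintro _ ⟨k, rfl⟩
      exact ⟨i k, harg k⟩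
    · ext o
      constructor
      · rintro ⟨j, rfl⟩
        by_cases hj : j ∈ Set.range i
        · obtain ⟨k, rfl⟩ := hj
          exact .inr ⟨k, (hres k).symm⟩
        · rw [hne j hj]
          refine .inl ⟨⟨j, rfl⟩, ?_⟩
          rintro ⟨k, hk⟩
          rw [← harg k] at hk
          exact hj ⟨k, S.occ.injective hk⟩
      · rintro (⟨⟨j, rfl⟩, h⟩ | ⟨k, rfl⟩)
        · refine ⟨j, hne j ?_⟩
          rintro ⟨k, rfl⟩
          exact h ⟨k, (harg k).symm⟩
        · exact ⟨i k, hres k⟩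

/-- Unoccupied targets ensure that the tokens remain on distinct occurrences, as states require. -/
theorem Hyper.exists_step {S : State π n} {I X : Set (Occ π)} (h : Hyper π I X)
    (hI : I.Nonempty) (hIS : I ⊆ Set.range S.occ) (hX : ∀ j, S.occ j ∉ X) : ∃ T, Step S T := by
  classical
  rcases h with ⟨h⟩ | ⟨g, hg⟩ | ⟨l, hl⟩
  · rename_i o o'
    obtain ⟨j, rfl⟩ := hIS rfl
    have hinj : (Function.update S.occ j o').Injective := by
      intro a b hab
      by_cases ha : a = j <;> by_cases hb : b = j
      · rw [ha, hb]
      · subst ha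
        rw [Function.update_self, Function.update_of_ne hb] at hab
        exact absurd hab.symm (hX b)
      · subst hb
        rw [Function.update_self, Function.update_of_ne ha] at hab
        exact absurd hab (hX a)
      · rw [Function.update_of_ne ha, Function.update_of_ne hb] at hab
        exact S.occ.injective hab
    refine ⟨⟨⟨_, hinj⟩, S.reg⟩, .move j ?_ ?_ rfl⟩
    · simpa using h
    · intro j' hj'
      exact Function.update_of_ne hj' _ _
  · obtain ⟨harg, hres⟩ := gate_injective π g hg
    choose i hi using fun k => hIS ⟨k, rfl⟩
    have hiinj : i.Injective := fun k k' h => harg (by rw [← hi k, ← hi k', h])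
    have hinj : (Function.extend i g.res S.occ).Injective := by
      intro a b hab
      by_cases ha : ∃ k, i k = a <;> by_cases hb : ∃ k, i k = b
      · obtain ⟨k, rfl⟩ := ha
        obtain ⟨k', rfl⟩ := hb
        rw [hiinj.extend_apply, hiinj.extend_apply] at hab
        rw [hres hab]
      · obtain ⟨k, rfl⟩ := ha
        rw [hiinj.extend_apply, Function.extend_apply' _ _ _ hb] at hab
        exact absurd ⟨k, hab⟩ (hX b)
      · obtain ⟨k, rfl⟩ := hb
        rw [hiinj.extend_apply, Function.extend_apply' _ _ _ ha] at hab
        exact absurd ⟨k, hab.symm⟩ (hX a)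
      · rw [Function.extend_apply' _ _ _ ha, Function.extend_apply' _ _ _ hb] at hab
        exact S.occ.injective hab
    exact ⟨⟨⟨_, hinj⟩, ⟨applyAt (𝒰.op g.sym).1 ⟨i, hiinj⟩ S.reg.1,
      (norm_applyAt _ _ _).trans S.reg.2⟩⟩, .fire g hg ⟨i, hiinj⟩ hi
        (fun k => hiinj.extend_apply _ _ k) (fun j hj => Function.extend_apply' _ _ _ hj) rfl⟩
  · exact hI.ne_empty.elim rfl

/-! ### The invariant of the machine -/

/-- `D` is the set of the occurrences that tokens have left in a run ending in `S`. -/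
structure Inv (D : Set (Occ π)) (S : State π n) : Prop where
  disj : ∀ j, S.occ j ∉ D
  input : ∀ j : JOcc Γ A, j.entry = true → root π j ∈ D ∪ Set.range S.occ
  bit : ∀ {X}, Hyper π ∅ X → X ⊆ D ∪ Set.range S.occ
  -- One consumed source means that the transition has fired, so all its targets are visited;
  -- conversely, in `bwd`, one visited target means that all sources were consumed.
  fwd : ∀ {I X o}, Hyper π I X → o ∈ I → o ∈ D → X ⊆ D ∪ Set.range S.occ
  bwd : ∀ {I X o}, Hyper π I X → o ∈ X → o ∈ D ∪ Set.range S.occ → I ⊆ D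
  output : ∀ j : JOcc Γ A, j.entry = false → root π j ∉ D

theorem Inv.step {D : Set (Occ π)} {S T : State π n} (h : Inv D S) (hST : Step S T) :
    ∃ D', Inv D' T ∧ D ⊂ D' := by
  obtain ⟨I, X, hIX, ⟨i, hi⟩, hIS, hT⟩ := hST.hyper
  have hID : ∀ o ∈ I, o ∉ D := by
    intro o ho
    obtain ⟨j, rfl⟩ := hIS ho
    exact h.disj j
  -- Targets are fresh: a visited one would, by `bwd`, mean that the transition had fired before,
  -- although `i` still carries a token.
  have hXV : ∀ o ∈ X, o ∉ D ∪ Set.range S.occ := fun o ho ho' => hID i hi (h.bwd hIX ho ho' hi)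
  have hV : (D ∪ I) ∪ Set.range T.occ = (D ∪ Set.range S.occ) ∪ X := by
    rw [hT]
    ext o
    have := @hIS o
    simp only [Set.mem_union, Set.mem_sdiff]
    tauto
  refine ⟨D ∪ I, ⟨?_, ?_, ?_, ?_, ?_, ?_⟩, Set.subset_union_left, fun hsub => ?_⟩
  · intro j
    have hj : T.occ j ∈ (Set.range S.occ \ I) ∪ X := hT ▸ ⟨j, rfl⟩
    rintro (hD | hI)
    · rcases hj with ⟨⟨j', hj'⟩, -⟩ | hj
      · exact h.disj j' (hj' ▸ hD)
      · exact hXV _ hj (.inl hD)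
    · rcases hj with ⟨-, hj⟩ | hj
      · exact hj hI
      · exact hXV _ hj (.inr (hIS hI))
  · intro j hj
    rw [hV]
    exact .inl (h.input j hj)
  · intro X' hX'
    rw [hV]
    exact (h.bit hX').trans Set.subset_union_left
  · intro I' X' o hIX' ho hoD
    rw [hV]
    rcases hoD with hoD | hoI
    · exact (h.fwd hIX' ho hoD).trans Set.subset_union_left
    -- A newly consumed occurrence is a source of no transition other than the one just fired;
    -- below, symmetrically for the new targets.
    · obtain ⟨-, rfl⟩ := (full π).1.uniq hIX' hIX ho hoI
      exact Set.subset_union_right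
  · intro I' X' o hIX' ho hoV
    rw [hV] at hoV
    rcases hoV with hoV | hoX
    · exact (h.bwd hIX' ho hoV).trans Set.subset_union_left
    · obtain ⟨-, rfl⟩ := (full π).2.uniq hIX' hIX ho hoX
      exact Set.subset_union_right
  · rintro j hj (hD | hI)
    · exact h.output j hj hD
    · have := (full π).1.entry hIX hI
      rw [hj] at this
      cases this
  · exact hID i hi (hsub (.inr hi))

theorem isFinal_of {S : State π n} (h : ∀ o, o ∈ Set.range S.occ ↔ o ∈ outputs π) :
    IsFinal S := by
  have h1 : ∀ j, ∃ k, (outputs π).get k = S.occ j := fun j => List.get_of_mem ((h _).1 ⟨j, rfl⟩)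
  choose σ hσ using h1
  have hinj : σ.Injective := fun a b hab => S.occ.injective (by rw [← hσ a, ← hσ b, hab])
  have hsurj : σ.Surjective := by
    intro k
    obtain ⟨j, hj⟩ := (h _).2 (List.get_mem (outputs π) k)
    exact ⟨j, (nodup_outputs π).injective_get ((hσ j).trans hj)⟩
  exact ⟨Equiv.ofBijective σ ⟨hinj, hsurj⟩, fun j => (hσ j).symm⟩

theorem Inv.progress {D : Set (Occ π)} {S : State π n} (h : Inv D S) :
    IsFinal S ∨ ∃ T, Step S T := by
  by_cases hV : ∀ o, o ∈ D ∪ Set.range S.occ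
  · refine .inl (isFinal_of fun o => ?_)
    rw [mem_outputs]
    constructor
    · rintro ⟨j, rfl⟩
      rcases (full π).1.total (S.occ j) with hj | ⟨I, X, hIX, hj⟩
      · exact hj
      · obtain ⟨o, ho⟩ := hIX.nonempty
        exact absurd (h.bwd hIX ho (hV o) hj) (h.disj j)
    · rintro ⟨j, hj, rfl⟩
      exact (hV _).resolve_left (h.output j hj)
  · push Not at hV
    -- Acyclicity enters only here: all sources of the transition producing `o` precede it, hence
    -- are visited. None has been consumed, as otherwise `fwd` would make `o` visited.
    obtain ⟨o, ho, hmin⟩ := (wellFounded_edge π).has_min {o | o ∉ D ∪ Set.range S.occ} hV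
    rcases (full π).2.total o with ⟨j, hj, rfl⟩ | ⟨X, I, hIX, hoX⟩
    · exact absurd (h.input j (by simpa using hj)) ho
    · have hIV : ∀ a ∈ I, a ∈ Set.range S.occ := by
        intro a ha
        have haV : a ∈ D ∪ Set.range S.occ := by
          by_contra haV
          exact hmin a haV (Hyper.edge hIX ha hoX)
        exact haV.resolve_left fun haD => ho (h.fwd hIX ha haD hoX)
      rcases I.eq_empty_or_nonempty with rfl | hI
      · exact absurd (h.bit hIX hoX) ho
      · refine .inr (Hyper.exists_step hIX hI hIV fun j hj => ?_)
        obtain ⟨a, ha⟩ := hI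
        obtain ⟨k, rfl⟩ := hIV a ha
        exact h.disj k (h.bwd hIX hj (.inr ⟨j, rfl⟩) ha)

theorem Inv.reaches {D : Set (Occ π)} {S T : State π n} (h : Inv D S) (hST : Reaches S T) :
    ∃ D', Inv D' T := by
  induction hST with
  | refl => exact ⟨D, h⟩
  | tail _ hstep ih =>
    obtain ⟨D', h'⟩ := ih
    obtain ⟨D'', h'', -⟩ := h'.step hstep
    exact ⟨D'', h''⟩

theorem Inv.terminates {D : Set (Occ π)} {S : State π n} (h : Inv D S) :
    ∃ F, Reaches S F ∧ IsFinal F := by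
  have := finite_occ π
  -- Each step puts at least one more occurrence into `D`, so the number of occurrences not yet left
  -- decreases.
  induction hm : (Dᶜ).ncard using Nat.strong_induction_on generalizing D S with
  | _ m ih =>
    rcases h.progress with hF | ⟨T, hT⟩
    · exact ⟨S, .refl, hF⟩
    · obtain ⟨D', h', hD⟩ := h.step hT
      obtain ⟨F, hTF, hF⟩ := ih _ (hm ▸ Set.ncard_lt_ncard (show D'ᶜ ⊂ Dᶜ by simpa using hD) (Set.toFinite _)) h' rfl
      exact ⟨F, .head hT hTF, hF⟩

/-! ### Initial states -/

/-- A bit axiom is a transition into its occurrence, and no transition ends at an entry. -/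
theorem root_ne_bit {j : JOcc Γ A} (hj : j.entry = true) {l : BitLeaf (Occ π)}
    (hl : l ∈ bitLeaves π) : root π j ≠ l.occ := by
  intro h
  have := (full π).2.entry (j := j) (Hyper.bit l hl) h
  simp [hj] at this

theorem IsInitial.mem_range {S : State π (tokens π)} {Q : Register (inputs π).length}
    (hS : IsInitial S Q) {o : Occ π} :
    o ∈ Set.range S.occ ↔ o ∈ inputs π ∨ ∃ l ∈ bitLeaves π, l.occ = o := by
  rw [hS.occ_eq]
  constructor
  · rintro ⟨j, rfl⟩
    refine Fin.addCases (fun j => ?_) (fun j => ?_) j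
    · rw [Fin.append_left]
      exact .inl (List.get_mem _ _)
    · rw [Fin.append_right]
      exact .inr ⟨_, mem_sortedBits.1 (List.get_mem _ _), rfl⟩
  · rintro (h | ⟨l, h, rfl⟩)
    · obtain ⟨j, rfl⟩ := List.get_of_mem h
      exact ⟨Fin.castAdd _ j, Fin.append_left _ _ _⟩
    · obtain ⟨j, rfl⟩ := List.get_of_mem (mem_sortedBits.2 h)
      exact ⟨Fin.natAdd _ j, Fin.append_right _ _ _⟩

/-- Nothing has been left yet, so the point is `bwd`: an occupied occurrence is an input, the target
of no transition, or a bit, whose only incoming transition has empty source. -/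
theorem IsInitial.inv {S : State π (tokens π)} {Q : Register (inputs π).length}
    (hS : IsInitial S Q) : Inv ∅ S where
  disj _ h := h
  input j hj := .inr (hS.mem_range.2 (.inl (mem_inputs.2 ⟨j, hj, rfl⟩)))
  bit := by
    intro X hX o ho
    generalize hI : (∅ : Set (Occ π)) = I at hX
    rcases hX with ⟨h⟩ | ⟨g, hg⟩ | ⟨l, hl⟩
    · exact absurd hI.symm (Set.singleton_ne_empty _)
    · have h0 : g.arg ⟨0, 𝒰.arity_pos g.sym⟩ ∈ (∅ : Set (Occ π)) := hI ▸ ⟨_, rfl⟩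
      exact h0.elim
    · exact .inr (hS.mem_range.2 (.inr ⟨l, hl, ho.symm⟩))
  fwd _ _ h := h.elim
  bwd := by
    intro I X o hIX ho hoV
    rcases hS.mem_range.1 (hoV.resolve_left id) with h | ⟨l, hl, rfl⟩
    · obtain ⟨j, hj, rfl⟩ := mem_inputs.1 h
      have := (full π).2.entry hIX ho
      simp [hj] at this
    · rw [((full π).2.uniq hIX (Hyper.bit l hl) ho rfl).2]
  output _ _ h := h

theorem exists_isInitial (π : Deriv 𝒰 Γ M A) (Q : Register (inputs π).length) :
    ∃ S : State π (tokens π), IsInitial S Q := by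
  have hinj : (Fin.append (inputs π).get fun j => ((sortedBits π).get j).occ).Injective := by
    rw [Fin.append_injective_iff]
    refine ⟨(nodup_inputs π).injective_get, fun a b hab => ?_, fun a b h => ?_⟩
    · exact (nodup_sortedBits π).of_map.injective_get
        (List.inj_on_of_nodup_map (nodup_sortedBits π) (List.get_mem _ _) (List.get_mem _ _) hab)
    · obtain ⟨j, hj, hja⟩ := mem_inputs.1 (List.get_mem (inputs π) a)
      exact root_ne_bit hj (mem_sortedBits.1 (List.get_mem _ b)) (hja.trans h)
  exact ⟨⟨⟨_, hinj⟩, ⟨_, (norm_tensBasis Q.1 _).trans Q.2⟩⟩, rfl, rfl⟩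

/-- `Computes` asks for a single result valid for all initial states; uniqueness reduces this to one
run. -/
theorem IsInitial.unique {S T : State π (tokens π)} {Q : Register (inputs π).length}
    (hS : IsInitial S Q) (hT : IsInitial T Q) : S = T := by
  obtain ⟨o, r⟩ := S
  obtain ⟨o', r'⟩ := T
  obtain rfl : o = o' := DFunLike.coe_injective (hS.occ_eq.trans hT.occ_eq.symm)
  obtain rfl : r = r' := Subtype.ext (hS.reg_eq.trans hT.reg_eq.symm)
  rfl

theorem norm_permute {m n : ℕ} (σ : Fin n ≃ Fin m) (v : QSpace n) :
    ‖(WithLp.toLp 2 fun b : Fin m → Bool => v (b ∘ σ) : QSpace m)‖ = ‖v‖ := by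
  rw [← sq_eq_sq₀ (norm_nonneg _) (norm_nonneg _), EuclideanSpace.norm_sq_eq,
    EuclideanSpace.norm_sq_eq]
  exact (Equiv.arrowCongr σ.symm (Equiv.refl Bool)).sum_comp fun b => ‖v b‖ ^ 2

end Machine

end QLambda

theorem mainTheorem2 (𝒰 : QLambda.Signature) (Γ : QLambda.Env) (M : QLambda.Term 𝒰)
    (A : QLambda.Ty) (hM : M.labels.Nodup) (π : QLambda.Deriv 𝒰 Γ M A) :
    (∀ (Q : QLambda.Register (QLambda.inputs π).length)
        (S R : QLambda.State π (QLambda.tokens π)),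
        QLambda.IsInitial S Q → QLambda.Reaches S R →
          QLambda.IsFinal R ∨ ∃ T : QLambda.State π (QLambda.tokens π), QLambda.Step R T) ∧
    (∀ Q : QLambda.Register (QLambda.inputs π).length,
        ∃ R : QLambda.Register (QLambda.outputs π).length, QLambda.Computes π Q R) := by
  refine ⟨fun Q S R hS hSR => ?_, fun Q => ?_⟩
  · obtain ⟨D, hD⟩ := hS.inv.reaches hSR
    exact hD.progress
  · obtain ⟨S, hS⟩ := QLambda.exists_isInitial π Q
    obtain ⟨F, hSF, σ, hσ⟩ := hS.inv.terminates
    refine ⟨⟨_, (QLambda.norm_permute σ F.reg.1).trans F.reg.2⟩, ⟨S, hS⟩, fun S' hS' => ?_⟩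
    rw [hS'.unique hS]
    exact ⟨F, σ, hSF, hσ, fun b => rfl⟩
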